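/- **Setting.** Consider the single-input single-output system $x_{k+1}=Ax_k+Bu_k$, $y_k=Cx_k$ with $A\in\mathbb R^{n_x\times n_x}$, spectral radius $\rho(A)<1$, $(A,B)$ controllable and $(A,C)$ observable. Let $g_k=CA^kB$ ($k\ge 0$) be its Markov parameters, $\bm g_n=[g_0,\dots,g_{n-1}]$, and $\bm a=[a_{n_x},\dots,a_1]$, where $z^{n_x}+a_1z^{n_x-1}+\cdots+a_{n_x}$ is the characteristic polynomial of $A$. For $n>n_x$ and $p=n-1-n_x$, let $\mathcal H\in\mathbb R^{(n_x+1)\times(p+1)}$ be the Hankel matrix with entries $g_{i+j}$ ($0\le i\le n_x$, $0\le j\le p$), $\mathcal H^+$ its first $n_x$ rows and $\mathcal H^-$ its last row; $\hat{\mathcal H}^{\pm}$ are the same matrices built from estimates $\hat{\bm g}_n$. Let $\mathcal T(\bm a)\in\mathbb R^{n\times(n-n_x)}$ be the Toeplitz matrix with first column $[a_{n_x},\dots,a_1,1,0,\dots,0]^\top$ and first row $[a_{n_x},0,\dots,0]$. **Asymptotic normality.** For random row vectors $X_N$ of dimension $d_N$ (possibly varying with $N$) and deterministic symmetric $d_N\times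 d_N$ matrices $P_N$, write $X_N\sim\mathrm{As}\mathcal N(0,P_N)$ if there are constants $0<c\le K$ with $cI\preccurlyeq P_N\preccurlyeq KI$ for all large $N$ and, for every fixed $m$ and every bounded sequence of deterministic matrices $\Upsilon_N\in\mathbb R^{d_N\times m}$ for which $\Upsilon_N^\top P_N\Upsilon_N$ converges to some $Q$, the vectors $X_N\Upsilon_N$ converge in distribution to $\mathcal N(0,Q)$. (For constant $d_N=d$ and constant $P_N=P\succ0$ this is convergence in distribution of $X_N$ to $\mathcal N(0,P)$.) **Assumptions.** The number $n=n(N)$ of Markov parameters satisfies $n(N)\to\infty$, $n(N)^{4+\delta}/N\to0$ for some $\delta>0$, and $\sqrt N\sum_{k>n(N)}|CA^{k-1}B|\to0$ as $N\to\infty$. The random vectors $\hat{\bm g}_{n}$ (depending on $N$, all on one probability space) satisfy $\|\hat{\bm g}_n-\bm g_n\|\to0$ with probability one, and $\sqrt N(\hat{\bm g}_n-\bm g_n)\sim\mathrm{As}\mathcal N(0,P_g)$, where $P_g=P_g(N)\in\mathbb R^{n\times n}$ is positive definite for every $N$. Put $W(\bm a)=(\mathcal T(\bm a)^\top P_g\mathcal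 T(\bm a))^{-1}$. **Estimates.** With $\Phi=(\hat{\mathcal H}^+)^\top$ and $z=-(\hat{\mathcal H}^-)^\top$, let $\hat{\bm a}_{\rm ols}^\top$ be the minimizer of $\|z-\Phi\theta\|$; $\hat{\bm a}_{\rm wls}^\top$ the minimizer of $(z-\Phi\theta)^\top W(\bm a)(z-\Phi\theta)$; and $\hat{\bm a}_{\rm tls}^\top$ the total least-squares solution, i.e. the $\theta$ with $(\Phi+\tilde\Phi)\theta=z+\tilde z$ for a perturbation $[\tilde\Phi\ \tilde z]$ of least Frobenius norm among those for which $z+\tilde z$ lies in the range of $\Phi+\tilde\Phi$. (Each estimate is set to $0$ if the corresponding solution does not exist or is not unique.) **Theorem.** Under these assumptions $$\sqrt N(\hat{\bm a}_{\rm ols}-\bm a)\sim\mathrm{As}\mathcal N(0,P_{\rm ols}),\quad \sqrt N(\hat{\bm a}_{\rm tls}-\bm a)\sim\mathrm{As}\mathcal N(0,P_{\rm tls}),\quad \sqrt N(\hat{\bm a}_{\rm wls}-\bm a)\sim\mathrm{As}\mathcal N(0,P_{\rm wls}),$$ where, with $\dagger$ the Moore–Penrose pseudo-inverse and $\mathcal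 H^+$, $W(\bm a)$ taken for $n=n(N)$, $$P_{\rm ols}=P_{\rm tls}=\big((\mathcal H^+)^\dagger\big)^\top W(\bm a)^{-1}(\mathcal H^+)^\dagger,\qquad P_{\rm wls}=\big(\mathcal H^+W(\bm a)(\mathcal H^+)^\top\big)^{-1}.$$ Moreover $P_{\rm ols}=P_{\rm tls}\succcurlyeq P_{\rm wls}$ for every $N$ with $n(N)\ge 2n_x+1$ (that is, $p\ge n_x$). -/

import Mathlib

open MeasureTheory ProbabilityTheory Filter Topology
open scoped Matrix

/-! ### The single-input single-output system `x_{k+1} = A x_k + B u_k`, `y_k = C x_k` -/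

/-- The spectral radius of the real matrix `A` (computed from its complex eigenvalues) is `< 1`. -/
def IsSchurStable {nx : ℕ} (A : Matrix (Fin nx) (Fin nx) ℝ) : Prop :=
  spectralRadius ℂ (A.map (algebraMap ℝ ℂ)) < 1

/-- `(A, B)` is controllable: `[B, AB, …, A^(nx-1) B]` has rank `nx`. -/
def IsControllable {nx : ℕ} (A : Matrix (Fin nx) (Fin nx) ℝ) (B : Fin nx → ℝ) : Prop :=
  (Matrix.of fun (i j : Fin nx) => ((A ^ (j : ℕ)) *ᵥ B) i).rank = nx

/-- `(A, C)` is observable: the matrix with rows `C, CA, …, C A^(nx-1)` has rank `nx`. -/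
def IsObservable {nx : ℕ} (A : Matrix (Fin nx) (Fin nx) ℝ) (C : Fin nx → ℝ) : Prop :=
  (Matrix.of fun (i j : Fin nx) => (C ᵥ* (A ^ (i : ℕ))) j).rank = nx

/-- The Markov parameter `g_k = C A^k B`, `k = 0, 1, 2, …`. -/
def markov {nx : ℕ} (A : Matrix (Fin nx) (Fin nx) ℝ) (B C : Fin nx → ℝ) (k : ℕ) : ℝ :=
  C ⬝ᵥ ((A ^ k) *ᵥ B)

/-- The vector of the first `n` Markov parameters. -/
def markovVec {nx : ℕ} (A : Matrix (Fin nx) (Fin nx) ℝ) (B C : Fin nx → ℝ) (n : ℕ) :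
    Fin n → ℝ :=
  fun k => markov A B C k

/-- The vector `a = [a_nx, …, a_1]`, where `z^nx + a_1 z^(nx-1) + ⋯ + a_nx` is the characteristic
polynomial of `A`. -/
noncomputable def charCoeffs {nx : ℕ} (A : Matrix (Fin nx) (Fin nx) ℝ) : Fin nx → ℝ :=
  fun i => A.charpoly.coeff i

/-! ### Hankel and Toeplitz matrices -/

/-- The Hankel matrix with `nx + 1` rows and `p + 1 = n - nx` columns built from `n` numbers;
its `(i, j)` entry is `g_{i+j}`. -/
def hankel (nx : ℕ) {n : ℕ} (g : Fin n → ℝ) : Matrix (Fin (nx + 1)) (Fin (n - nx)) ℝ :=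
  Matrix.of fun i j => g ⟨(i : ℕ) + j, by omega⟩

/-- The first `nx` rows `H⁺` of the Hankel matrix. -/
def hankelTop (nx : ℕ) {n : ℕ} (g : Fin n → ℝ) : Matrix (Fin nx) (Fin (n - nx)) ℝ :=
  Matrix.of fun i j => hankel nx g i.castSucc j

/-- The last row `H⁻` of the Hankel matrix. -/
def hankelBot (nx : ℕ) {n : ℕ} (g : Fin n → ℝ) : Fin (n - nx) → ℝ :=
  fun j => hankel nx g (Fin.last nx) j

/-- The `n × (n - nx)` banded Toeplitz matrix `T(a)` with first column
`[a_nx, …, a_1, 1, 0, …, 0]ᵀ` and first row `[a_nx, 0, …, 0]`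
(here `a 0 = a_nx`, …, `a (nx - 1) = a_1`). -/
def toeplitz {nx : ℕ} (a : Fin nx → ℝ) (n : ℕ) : Matrix (Fin n) (Fin (n - nx)) ℝ :=
  Matrix.of fun k j =>
    if h : (j : ℕ) ≤ k ∧ (k : ℕ) - j < nx then a ⟨(k : ℕ) - j, h.2⟩
    else if (k : ℕ) = j + nx then 1 else 0

/-- The weight `W(a) = (T(a)ᵀ P T(a))⁻¹`. -/
noncomputable def weight {nx n : ℕ} (a : Fin nx → ℝ) (P : Matrix (Fin n) (Fin n) ℝ) :
    Matrix (Fin (n - nx)) (Fin (n - nx)) ℝ :=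
  ((toeplitz a n)ᵀ * P * toeplitz a n)⁻¹

/-! ### Least-squares problems for `z ≈ Φ θ` -/

/-- `θ` minimizes `‖z - Φ θ‖`. -/
def IsOLS {m l : ℕ} (Φ : Matrix (Fin m) (Fin l) ℝ) (z : Fin m → ℝ) (θ : Fin l → ℝ) : Prop :=
  ∀ θ' : Fin l → ℝ, (z - Φ *ᵥ θ) ⬝ᵥ (z - Φ *ᵥ θ) ≤ (z - Φ *ᵥ θ') ⬝ᵥ (z - Φ *ᵥ θ')

/-- `θ` minimizes `(z - Φ θ)ᵀ W (z - Φ θ)`. -/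
def IsWLS {m l : ℕ} (W : Matrix (Fin m) (Fin m) ℝ) (Φ : Matrix (Fin m) (Fin l) ℝ)
    (z : Fin m → ℝ) (θ : Fin l → ℝ) : Prop :=
  ∀ θ' : Fin l → ℝ,
    (z - Φ *ᵥ θ) ⬝ᵥ (W *ᵥ (z - Φ *ᵥ θ)) ≤ (z - Φ *ᵥ θ') ⬝ᵥ (W *ᵥ (z - Φ *ᵥ θ'))

/-- The perturbation `[E e]` of `[Φ z]` is feasible for the total least-squares problem:
`z + e` lies in the range of `Φ + E`. -/
def TLSFeasible {m l : ℕ} (Φ : Matrix (Fin m) (Fin l) ℝ) (z : Fin m → ℝ)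
    (E : Matrix (Fin m) (Fin l) ℝ) (e : Fin m → ℝ) : Prop :=
  ∃ θ : Fin l → ℝ, (Φ + E) *ᵥ θ = z + e

/-- The squared Frobenius norm of `[E e]`. -/
def frobSq {m l : ℕ} (E : Matrix (Fin m) (Fin l) ℝ) (e : Fin m → ℝ) : ℝ :=
  (∑ i, ∑ j, E i j ^ 2) + ∑ i, e i ^ 2

/-- `θ` is a total least-squares solution: `(Φ + E) θ = z + e` for some feasible `[E e]` of minimal
Frobenius norm. -/
def IsTLS {m l : ℕ} (Φ : Matrix (Fin m) (Fin l) ℝ) (z : Fin m → ℝ) (θ : Fin l → ℝ) : Prop :=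
  ∃ (E : Matrix (Fin m) (Fin l) ℝ) (e : Fin m → ℝ),
    (∀ E' e', TLSFeasible Φ z E' e' → frobSq E e ≤ frobSq E' e') ∧ (Φ + E) *ᵥ θ = z + e

open Classical in
/-- The unique vector with the property `S`; the value is `0` if there is not exactly one. -/
noncomputable def uniqueSol {l : ℕ} (S : (Fin l → ℝ) → Prop) : Fin l → ℝ :=
  if h : ∃! θ, S θ then h.choose else 0

/-! ### The three estimates of `a`, obtained from (estimated) Markov parameters `g`
by fitting `a H⁺ ≈ -H⁻` -/

/-- The ordinary least-squares estimate. -/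
noncomputable def aOLS (nx : ℕ) {n : ℕ} (g : Fin n → ℝ) : Fin nx → ℝ :=
  uniqueSol (IsOLS (hankelTop nx g)ᵀ (-hankelBot nx g))

/-- The total least-squares estimate. -/
noncomputable def aTLS (nx : ℕ) {n : ℕ} (g : Fin n → ℝ) : Fin nx → ℝ :=
  uniqueSol (IsTLS (hankelTop nx g)ᵀ (-hankelBot nx g))

/-- The weighted least-squares estimate with weight `W`. -/
noncomputable def aWLS (nx : ℕ) {n : ℕ} (W : Matrix (Fin (n - nx)) (Fin (n - nx)) ℝ)
    (g : Fin n → ℝ) : Fin nx → ℝ :=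
  uniqueSol (IsWLS W (hankelTop nx g)ᵀ (-hankelBot nx g))

/-! ### The asymptotic covariances -/

/-- `X` is the Moore–Penrose pseudo-inverse of the real matrix `M`. -/
def IsMoorePenrose {r s : ℕ} (M : Matrix (Fin r) (Fin s) ℝ) (X : Matrix (Fin s) (Fin r) ℝ) : Prop :=
  M * X * M = M ∧ X * M * X = X ∧ (M * X)ᵀ = M * X ∧ (X * M)ᵀ = X * M

open Classical in
/-- The Moore–Penrose pseudo-inverse `M†` (it always exists and is unique). -/
noncomputable def pinv {r s : ℕ} (M : Matrix (Fin r) (Fin s) ℝ) : Matrix (Fin s) (Fin r) ℝ :=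
  if h : ∃ X, IsMoorePenrose M X then h.choose else 0

/-- `((H⁺)†)ᵀ W⁻¹ (H⁺)†`, the covariance for ordinary and for total least squares. -/
noncomputable def covLS (nx : ℕ) {n : ℕ} (W : Matrix (Fin (n - nx)) (Fin (n - nx)) ℝ)
    (g : Fin n → ℝ) : Matrix (Fin nx) (Fin nx) ℝ :=
  (pinv (hankelTop nx g))ᵀ * W⁻¹ * pinv (hankelTop nx g)

/-- `(H⁺ W (H⁺)ᵀ)⁻¹`, the covariance for weighted least squares. -/
noncomputable def covWLS (nx : ℕ) {n : ℕ} (W : Matrix (Fin (n - nx)) (Fin (n - nx)) ℝ)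
    (g : Fin n → ℝ) : Matrix (Fin nx) (Fin nx) ℝ :=
  (hankelTop nx g * W * (hankelTop nx g)ᵀ)⁻¹

/-! ### Asymptotic normality -/

/-- `X_N ∼ AsN(0, P_N)` for random row vectors `X_N ∈ ℝ^(d N)` whose dimension may vary with `N`:
the matrices `P_N` are, for large `N`, bounded and bounded away from singularity uniformly in `N`,
and for every fixed `m` and every bounded sequence of deterministic `d N × m` matrices `Υ_N` such
that `Υ_Nᵀ P_N Υ_N` converges to some `Q`, the vectors `X_N Υ_N` converge in distribution to
`𝒩(0, Q)`. If `d N = d` and `P_N = P` are constant, this is the usual notion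
`X_N → 𝒩(0, P)` in distribution (take `Υ_N = 1`), with `P` positive definite. -/
def AsymptoticallyNormal {Ω : Type*} [MeasurableSpace Ω] (μ : Measure Ω) [IsProbabilityMeasure μ]
    (d : ℕ → ℕ) (X : (N : ℕ) → Ω → Fin (d N) → ℝ)
    (P : (N : ℕ) → Matrix (Fin (d N)) (Fin (d N)) ℝ) : Prop :=
  (∃ c K : ℝ, 0 < c ∧
    ∀ᶠ N in atTop, (P N - c • 1).PosSemidef ∧ (K • 1 - P N).PosSemidef) ∧
  ∀ (m : ℕ) (Υ : (N : ℕ) → Matrix (Fin (d N)) (Fin m) ℝ) (Q : Matrix (Fin m) (Fin m) ℝ),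
    (∃ K : ℝ, ∀ N, ∑ i, ∑ j, Υ N i j ^ 2 ≤ K) →
    Tendsto (fun N => (Υ N)ᵀ * P N * Υ N) atTop (𝓝 Q) →
    TendstoInDistribution (fun N ω => WithLp.toLp 2 (X N ω ᵥ* Υ N)) atTop
      (id : EuclideanSpace ℝ (Fin m) → EuclideanSpace ℝ (Fin m)) (fun _ => μ)
      (multivariateGaussian 0 Q)

/-! Write `g` for the exact Markov parameters, `x` for their estimation error, `H` for `H⁺` built
from `g` and `Ĥ` for `H⁺` built from `g + x`. By Cayley–Hamilton `T(a)ᵀ g = 0`, so the regression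
residual at the true `a` is exactly `-T(a)ᵀ x` (`hankel_residual_eq`,
`toeplitz_transpose_mulVec_markovVec`). The weighted least-squares error `D` therefore solves `(Ĥ W
Ĥᵀ) D = -Ĥ W T(a)ᵀ x`, and replacing `Ĥ` by `H` costs only `O(‖x‖²)`: `D ≈ L x` with `L = -(H W
Hᵀ)⁻¹ H W T(a)ᵀ`. Total least squares minimizes `‖z - Φ θ‖² / (1 + ‖θ‖²)`; its normal equations
differ from the ordinary ones by a term `c θ`, where `c`, the minimal value, is at most `‖T(a)ᵀ
x‖²`. This is of second order, so both estimates have the same linearization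
(`exists_linearization`).

As the dimension grows, all constants must be independent of `n`. `H` is bounded because the Markov
parameters are summable, and `H Hᵀ` is bounded below because `H` contains the product of the
observability and controllability matrices as a block. `T(a)` is bounded above and below because it
multiplies polynomials by one whose roots lie in the open unit disc.

It remains that `√N ‖x‖² → 0` in probability. Asymptotic normality only speaks of finitely many
linear functionals at a time, yet it forces `‖√N x‖ = O_p(√n)`: at least 3/14 of all sign vectors
have inner product at least `‖X‖ / 2` with a given `X`, so the tail of `‖X‖` is controlled by that
of the worst sign direction, which after scaling is an admissible test direction
(`AsymptoticallyNormal.exists_tail_bound`). Thus the scaled remainder is `O_p(n / √N)`, and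
Slutsky's theorem transfers the limit law of `L x`, with covariance `L P Lᵀ`, to the estimates
(`AsymptoticallyNormal.of_linearization`).

The covariance comparison is Gauss–Markov: the difference is `(L₁ - L_W) W⁻¹ (L₁ - L_W)ᵀ` for the
two regression gains. -/

/-- The Euclidean norm of a vector given by its coordinates. -/
noncomputable abbrev eucNorm {ι : Type*} [Fintype ι] (v : ι → ℝ) : ℝ := ‖WithLp.toLp 2 v‖

/-! ### Euclidean norm and dot product -/

section EucNorm
variable {ι : Type*} [Fintype ι]

lemma eucNorm_sq (v : ι → ℝ) : eucNorm v ^ 2 = v ⬝ᵥ v := by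
  rw [EuclideanSpace.norm_sq_eq]
  simp [dotProduct, sq]

lemma eucNorm_eq_sqrt (v : ι → ℝ) : eucNorm v = √(v ⬝ᵥ v) := by
  rw [← eucNorm_sq, Real.sqrt_sq (norm_nonneg _)]

lemma eucNorm_add_le (v w : ι → ℝ) : eucNorm (v + w) ≤ eucNorm v + eucNorm w :=
  norm_add_le (WithLp.toLp 2 v) (WithLp.toLp 2 w)

lemma eucNorm_smul (c : ℝ) (v : ι → ℝ) : eucNorm (c • v) = |c| * eucNorm v :=
  norm_smul c (WithLp.toLp 2 v)

lemma eucNorm_neg (v : ι → ℝ) : eucNorm (-v) = eucNorm v :=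
  norm_neg (WithLp.toLp 2 v)

lemma dotProduct_self_nonneg' (v : ι → ℝ) : 0 ≤ v ⬝ᵥ v := by
  rw [← eucNorm_sq]; positivity

lemma abs_dotProduct_le (v w : ι → ℝ) : |v ⬝ᵥ w| ≤ eucNorm v * eucNorm w := by
  have h := abs_real_inner_le_norm (WithLp.toLp 2 w) (WithLp.toLp 2 v)
  rw [EuclideanSpace.inner_toLp_toLp] at h
  simpa [mul_comm] using h

end EucNorm

/-! ### Random signs -/

/-- The vector of signs `±1` encoded by a vector of truth values. -/
def signVec {n : ℕ} (s : Fin n → Bool) : Fin n → ℝ := fun i => if s i then 1 else -1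

/-- Conditioning on the first sign; this drives the moment computations below by induction on the
dimension. -/
lemma sum_signVec_succ {n : ℕ} (f : ℝ → ℝ) (x : Fin (n + 1) → ℝ) :
    ∑ s : Fin (n + 1) → Bool, f (signVec s ⬝ᵥ x) =
      ∑ s : Fin n → Bool, (f (x 0 + signVec s ⬝ᵥ Fin.tail x) +
        f (-x 0 + signVec s ⬝ᵥ Fin.tail x)) := by
  rw [← (Fin.consEquiv (fun _ => Bool)).sum_comp, Fintype.sum_prod_type, Fintype.sum_bool,
    ← Finset.sum_add_distrib]
  simp [Fin.consEquiv, signVec, dotProduct, Fin.sum_univ_succ, Fin.tail]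

lemma dotProduct_self_succ {n : ℕ} (x : Fin (n + 1) → ℝ) :
    x ⬝ᵥ x = x 0 ^ 2 + Fin.tail x ⬝ᵥ Fin.tail x := by
  simp [dotProduct, Fin.sum_univ_succ, Fin.tail, sq]

lemma sum_signVec_sq {n : ℕ} (x : Fin n → ℝ) :
    ∑ s : Fin n → Bool, (signVec s ⬝ᵥ x) ^ 2 = 2 ^ n * (x ⬝ᵥ x) := by
  induction n with
  | zero => simp [dotProduct]
  | succ n ih =>
    rw [sum_signVec_succ (fun t => t ^ 2), dotProduct_self_succ]
    have : ∀ s : Fin n → Bool, (x 0 + signVec s ⬝ᵥ Fin.tail x) ^ 2 +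
        (-x 0 + signVec s ⬝ᵥ Fin.tail x) ^ 2
        = 2 * x 0 ^ 2 + 2 * (signVec s ⬝ᵥ Fin.tail x) ^ 2 := fun s => by ring
    simp_rw [this, Finset.sum_add_distrib, ← Finset.mul_sum, ih]
    simp
    ring

/-- Khinchine's inequality for the fourth moment, with the Gaussian constant 3: odd powers of the
first coordinate cancel, and the mixed term is the second moment already known. -/
lemma sum_signVec_fourth_le {n : ℕ} (x : Fin n → ℝ) :
    ∑ s : Fin n → Bool, (signVec s ⬝ᵥ x) ^ 4 ≤ 3 * 2 ^ n * (x ⬝ᵥ x) ^ 2 := by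
  induction n with
  | zero => simp [dotProduct]
  | succ n ih =>
    rw [sum_signVec_succ (fun t => t ^ 4), dotProduct_self_succ]
    have : ∀ s : Fin n → Bool, (x 0 + signVec s ⬝ᵥ Fin.tail x) ^ 4 +
        (-x 0 + signVec s ⬝ᵥ Fin.tail x) ^ 4
        = 2 * x 0 ^ 4 + 12 * x 0 ^ 2 * (signVec s ⬝ᵥ Fin.tail x) ^ 2 +
          2 * (signVec s ⬝ᵥ Fin.tail x) ^ 4 := fun s => by ring
    simp_rw [this, Finset.sum_add_distrib, ← Finset.mul_sum, sum_signVec_sq]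
    have h := ih (Fin.tail x)
    simp
    have h2 : (0 : ℝ) ≤ 2 ^ n * x 0 ^ 4 := by positivity
    rw [pow_succ (2 : ℝ) n]
    nlinarith

/-- A positive fraction of all sign vectors has a large inner product with `x`
(Paley–Zygmund inequality). -/
lemma three_mul_two_pow_le_card_signVec {n : ℕ} (x : Fin n → ℝ) :
    3 * 2 ^ n ≤ 14 * (Finset.univ.filter
      (fun s : Fin n → Bool => eucNorm x / 2 ≤ |signVec s ⬝ᵥ x|)).card := by
  rcases (norm_nonneg (WithLp.toLp 2 x)).eq_or_lt with h0 | h0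
  · have : (Finset.univ.filter
      (fun s : Fin n → Bool => eucNorm x / 2 ≤ |signVec s ⬝ᵥ x|)) = Finset.univ := by
      refine Finset.filter_true_of_mem fun s _ => ?_
      rw [eucNorm, ← h0]; simp
    rw [this]
    simp
  -- With `t = (s ⬝ᵥ x)²` and `q = ‖x‖²`: `8qt - t² ≤ 16q²` always, and `8qt ≤ 2q²` when `t < q/4`.
  -- Averaging over `s`, the left side is at least `(8 - 3 - 2) q² = 3q²`, whence the fraction 3/14.
  · have key : ∀ s : Fin n → Bool,
        8 * eucNorm x ^ 2 * (signVec s ⬝ᵥ x) ^ 2 - (signVec s ⬝ᵥ x) ^ 4 - 2 * (eucNorm x) ^ 4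
          ≤ 14 * eucNorm x ^ 4 * (if eucNorm x / 2 ≤ |signVec s ⬝ᵥ x| then 1 else 0) := by
      intro s
      split_ifs with h
      · nlinarith [sq_nonneg ((signVec s ⬝ᵥ x) ^ 2 - 4 * eucNorm x ^ 2)]
      · push Not at h
        have h1 : (signVec s ⬝ᵥ x) ^ 2 ≤ (eucNorm x / 2) ^ 2 := by
          rw [← sq_abs]; gcongr
        have h2 : 0 ≤ eucNorm x ^ 2 := by positivity
        nlinarith [mul_le_mul_of_nonneg_left h1 h2, sq_nonneg ((signVec s ⬝ᵥ x) ^ 2)]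
    have hs := Finset.sum_le_sum fun s (_ : s ∈ Finset.univ) => key s
    rw [← Finset.mul_sum, Finset.sum_sub_distrib, Finset.sum_sub_distrib, ← Finset.mul_sum,
      sum_signVec_sq, ← eucNorm_sq, Finset.sum_boole] at hs
    have h4 := sum_signVec_fourth_le x
    rw [← eucNorm_sq] at h4
    simp at hs
    have hpos : 0 < eucNorm x ^ 4 := by positivity
    have : (3 * 2 ^ n : ℝ) * eucNorm x ^ 4 ≤ (14 * (Finset.univ.filter
      (fun s : Fin n → Bool => eucNorm x / 2 ≤ |signVec s ⬝ᵥ x|)).card : ℝ) * eucNorm x ^ 4 := by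
      nlinarith
    exact_mod_cast le_of_mul_le_mul_right this hpos

/-- If every point of `s` lies in at least `k` of the sets `t i`, up to a factor `l`, then
`k * μ s ≤ l * ∑ i, μ (t i)`. -/
lemma mul_measure_le_sum_measure {Ω ι : Type*} [MeasurableSpace Ω] [Fintype ι] (μ : Measure Ω)
    {s : Set Ω} {t : ι → Set Ω} (ht : ∀ i, NullMeasurableSet (t i) μ) (k l : ℕ)
    (h : ∀ ω ∈ s, ∀ [DecidablePred fun i => ω ∈ t i],
      k ≤ l * (Finset.univ.filter fun i => ω ∈ t i).card) :
    k * μ s ≤ l * ∑ i, μ (t i) := by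
  classical
  have hmeas : ∀ i, AEMeasurable ((t i).indicator fun _ => (1 : ENNReal)) μ := fun i =>
    (aemeasurable_indicator_const_iff (1 : ENNReal)).2 (ht i)
  have h1 : ∑ i, μ (t i) = ∫⁻ ω, ∑ i, (t i).indicator (fun _ => (1 : ENNReal)) ω ∂μ := by
    rw [lintegral_finsetSum' _ fun i _ => hmeas i]
    refine Finset.sum_congr rfl fun i _ => ?_
    exact (lintegral_indicator_one₀ (ht i)).symm
  rw [h1, ← lintegral_const_mul' _ _ (by simp)]
  calc (k : ENNReal) * μ s ≤ k * μ {ω | (k : ENNReal) ≤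
        l * ∑ i, (t i).indicator (fun _ => (1 : ENNReal)) ω} := by
        gcongr
        intro ω hω
        have := h ω hω
        simp only [Set.mem_ofPred_eq, Set.indicator_apply, Finset.sum_boole]
        exact_mod_cast this
    _ ≤ _ := by
        refine mul_meas_ge_le_lintegral₀ ?_ _
        refine AEMeasurable.const_mul ?_ _
        exact Finset.aemeasurable_fun_sum _ fun i _ => hmeas i

/-! ### Loewner bounds as bounds on quadratic forms -/

section Loewner
variable {ι : Type*} [Fintype ι] [DecidableEq ι] {M : Matrix ι ι ℝ} {c : ℝ}

lemma le_dotProduct_mulVec_of_posSemidef (h : (M - c • 1).PosSemidef) (v : ι → ℝ) :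
    c * (v ⬝ᵥ v) ≤ v ⬝ᵥ (M *ᵥ v) := by
  have := h.dotProduct_mulVec_nonneg v
  simp [Matrix.sub_mulVec, Matrix.smul_mulVec, dotProduct_sub] at this
  linarith

lemma dotProduct_mulVec_le_of_posSemidef (h : (c • 1 - M).PosSemidef) (v : ι → ℝ) :
    v ⬝ᵥ (M *ᵥ v) ≤ c * (v ⬝ᵥ v) := by
  have := h.dotProduct_mulVec_nonneg v
  simp [Matrix.sub_mulVec, Matrix.smul_mulVec, dotProduct_sub] at this
  linarith

lemma posSemidef_sub_smul_one (hM : M.IsHermitian)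
    (h : ∀ v, c * (v ⬝ᵥ v) ≤ v ⬝ᵥ (M *ᵥ v)) : (M - c • 1).PosSemidef := by
  refine Matrix.PosSemidef.of_dotProduct_mulVec_nonneg
    (hM.sub (by simp [Matrix.IsHermitian])) fun v => ?_
  simp [Matrix.sub_mulVec, Matrix.smul_mulVec, dotProduct_sub]
  linarith [h v]

lemma posSemidef_smul_one_sub (hM : M.IsHermitian)
    (h : ∀ v, v ⬝ᵥ (M *ᵥ v) ≤ c * (v ⬝ᵥ v)) : (c • 1 - M).PosSemidef := by
  refine Matrix.PosSemidef.of_dotProduct_mulVec_nonneg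
    (Matrix.IsHermitian.sub (by simp [Matrix.IsHermitian]) hM) fun v => ?_
  simp [Matrix.sub_mulVec, Matrix.smul_mulVec, dotProduct_sub]
  linarith [h v]

end Loewner

lemma signVec_dotProduct_self {n : ℕ} (s : Fin n → Bool) : signVec s ⬝ᵥ signVec s = n := by
  have : ∀ i, signVec s i * signVec s i = 1 := fun i => by
    unfold signVec; split_ifs <;> norm_num
  simp [dotProduct, this]

/-- A finite measure on a normed space is small outside a large ball. -/
lemma exists_measure_norm_ge_lt {E : Type*} [SeminormedAddCommGroup E] [MeasurableSpace E]
    [OpensMeasurableSpace E] (ν : Measure E) [IsFiniteMeasure ν] {ε : ENNReal} (hε : 0 < ε) :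
    ∃ M : ℝ, 0 ≤ M ∧ ν {x | M ≤ ‖x‖} < ε := by
  have h := tendsto_measure_iInter_atTop (μ := ν) (s := fun k : ℕ => {x : E | (k : ℝ) ≤ ‖x‖})
    (fun k => (isClosed_le continuous_const continuous_norm).measurableSet.nullMeasurableSet)
    (fun i j hij x hx => le_trans (by exact_mod_cast hij) (Set.mem_ofPred_eq ▸ hx))
    ⟨0, measure_ne_top _ _⟩
  have hempty : ⋂ k : ℕ, {x : E | (k : ℝ) ≤ ‖x‖} = ∅ := by
    ext x
    obtain ⟨k, hk⟩ := exists_nat_gt ‖x‖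
    simp only [Set.mem_iInter, Set.mem_ofPred_eq, Set.mem_empty_iff_false, iff_false, not_forall,
      not_le]
    exact ⟨k, hk⟩
  rw [hempty, measure_empty] at h
  obtain ⟨k, hk⟩ := (h.eventually (gt_mem_nhds hε)).exists
  exact ⟨k, by positivity, hk⟩

/-! ### Tail bound for the norm of an asymptotically normal vector -/

section Tightness
variable {Ω : Type*} [MeasurableSpace Ω] {μ : Measure Ω} [IsProbabilityMeasure μ]
    {d : ℕ → ℕ} {X : (N : ℕ) → Ω → Fin (d N) → ℝ}
    {P : (N : ℕ) → Matrix (Fin (d N)) (Fin (d N)) ℝ}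

/-- Asymptotic normality forces `‖X_N‖ = O_p(√(d N))`. -/
lemma AsymptoticallyNormal.exists_tail_bound (h : AsymptoticallyNormal μ d X P)
    (hX : ∀ N, AEMeasurable (X N) μ) (hd : ∀ᶠ N in atTop, 0 < d N)
    {ε : ENNReal} (hε : 0 < ε) :
    ∃ M : ℝ, 0 < M ∧ ∀ᶠ N in atTop, μ {ω | M * √(d N) ≤ eucNorm (X N ω)} ≤ ε := by
  classical
  obtain ⟨⟨c, K, hc, hcK⟩, hlim⟩ := h
  -- The share `ε / 5` absorbs the factor 14/3 lost in the averaging over signs, since `14 / 5 ≤ 3`.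
  obtain ⟨M, hM0, hM⟩ := exists_measure_norm_ge_lt
    (multivariateGaussian (0 : EuclideanSpace ℝ (Fin 1)) 1) (ε := ε / 5)
    (ENNReal.div_pos hε.ne' (by norm_num))
  let good : ℕ → Prop := fun N =>
    0 < d N ∧ (P N - c • 1).PosSemidef ∧ (K • 1 - P N).PosSemidef
  have hgood : ∀ᶠ N in atTop, good N := by
    filter_upwards [hd, hcK] with N h1 h2 using ⟨h1, h2⟩
  let q : (N : ℕ) → (Fin (d N) → Bool) → ℝ := fun N s => signVec s ⬝ᵥ (P N *ᵥ signVec s)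
  have hq : ∀ N, good N → ∀ s, 0 < q N s ∧ c * d N ≤ q N s ∧ q N s ≤ K * d N := by
    intro N hN s
    have h1 := le_dotProduct_mulVec_of_posSemidef hN.2.1 (signVec s)
    have h2 := dotProduct_mulVec_le_of_posSemidef hN.2.2 (signVec s)
    rw [signVec_dotProduct_self] at h1 h2
    have : 0 < c * d N := mul_pos hc (by exact_mod_cast hN.1)
    exact ⟨this.trans_le h1, h1, h2⟩
  -- Each sign vector is scaled to have `P N`-variance 1, so the limit is the standard Gaussian on
  -- the line.
  let V : (N : ℕ) → (Fin (d N) → Bool) → Matrix (Fin (d N)) (Fin 1) ℝ := fun N s =>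
    Matrix.of fun i _ => signVec s i / √(q N s)
  let B : (N : ℕ) → (Fin (d N) → Bool) → Set Ω := fun N s =>
    {ω | M ≤ ‖(WithLp.toLp 2 (X N ω ᵥ* V N s) : EuclideanSpace ℝ (Fin 1))‖}
  -- Convergence is available only along one deterministic sequence of directions. Taking the worst
  -- sign vector for each `N` makes the bound uniform over all of them.
  have hmax : ∀ N, ∃ s, ∀ s', μ (B N s') ≤ μ (B N s) := fun N =>
    Finite.exists_max fun s => μ (B N s)
  choose s hs using hmax
  -- Test directions must be bounded for every `N`, not just eventually; hence the value 0 where the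
  -- bounds on `P N` may fail.
  let Υ : (N : ℕ) → Matrix (Fin (d N)) (Fin 1) ℝ := fun N => if good N then V N (s N) else 0
  have hdist := hlim 1 Υ 1 ⟨c⁻¹, fun N => ?_⟩ ?_
  rotate_left
  · by_cases hN : good N
    · simp only [Υ, if_pos hN, V, Matrix.of_apply]
      obtain ⟨h1, h2, -⟩ := hq N hN (s N)
      simp only [div_pow, Real.sq_sqrt h1.le, Finset.univ_unique, Finset.sum_const,
        Finset.card_singleton, one_smul]
      rw [← Finset.sum_div]
      have : ∑ i, signVec (s N) i ^ 2 = d N := by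
        rw [← signVec_dotProduct_self (s N)]; simp [dotProduct, sq]
      rw [this, div_le_iff₀ h1, ← div_eq_inv_mul, le_div_iff₀ hc]
      linarith
    · simp [Υ, if_neg hN, hc.le]
  · refine tendsto_const_nhds.congr' ?_
    filter_upwards [hgood] with N hN
    obtain ⟨h1, -⟩ := hq N hN (s N)
    have h3 : q N (s N) = ∑ i, signVec (s N) i * ∑ j, P N i j * signVec (s N) j := rfl
    ext i j
    simp only [Υ, if_pos hN, V]
    rw [Matrix.mul_assoc]
    obtain rfl := Subsingleton.elim i j
    simp only [Matrix.one_apply_eq, Matrix.mul_apply,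
      Matrix.transpose_apply, Matrix.of_apply, mul_div_assoc']
    simp only [← Finset.sum_div, div_mul_eq_mul_div, mul_div_assoc']
    rw [← h3, div_div, Real.mul_self_sqrt h1.le, div_self h1.ne']
  have hclosed : IsClosed {x : EuclideanSpace ℝ (Fin 1) | M ≤ ‖x‖} :=
    isClosed_le continuous_const continuous_norm
  have hlimsup := ProbabilityMeasure.limsup_measure_closed_le_of_tendsto hdist.tendsto hclosed
  simp only [ProbabilityMeasure.coe_mk, Measure.map_id] at hlimsup
  have hev := eventually_lt_of_limsup_lt (hlimsup.trans_lt hM)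
  -- A sign vector has variance at most `K d`, so half of `2 √K M √d` still exceeds `M` standard
  -- deviations. The summand 1 keeps the constant positive.
  refine ⟨2 * √K * M + 1, by positivity, ?_⟩
  filter_upwards [hev, hgood] with N h1 hN
  rw [Measure.map_apply_of_aemeasurable (hdist.forall_aemeasurable N) hclosed.measurableSet] at h1
  have h2 : ∀ t, μ (B N t) ≤ ε / 5 := fun t => (hs N t).trans (by
    simp only [Υ, if_pos hN] at h1
    exact h1.le)
  have hBm : ∀ t, NullMeasurableSet (B N t) μ := fun t => by
    have hlin : Measurable fun x : Fin (d N) → ℝ =>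
        ‖(WithLp.toLp 2 (x ᵥ* V N t) : EuclideanSpace ℝ (Fin 1))‖ := by
      refine Continuous.measurable ?_
      refine continuous_norm.comp ((PiLp.continuous_toLp 2 _).comp ?_)
      exact Continuous.matrix_vecMul continuous_id continuous_const
    exact nullMeasurableSet_le aemeasurable_const (hlin.comp_aemeasurable (hX N))
  have hcount := mul_measure_le_sum_measure μ hBm (3 * 2 ^ d N) 14
    (s := {ω | (2 * √K * M + 1) * √(d N) ≤ eucNorm (X N ω)}) ?_
  · have h3 : ((3 * 2 ^ d N : ℕ) : ENNReal) *
        μ {ω | (2 * √K * M + 1) * √(d N) ≤ eucNorm (X N ω)} ≤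
        ((3 * 2 ^ d N : ℕ) : ENNReal) * ε := by
      refine hcount.trans ?_
      calc ((14 : ℕ) : ENNReal) * ∑ t, μ (B N t)
          ≤ ((14 : ℕ) : ENNReal) * ∑ t : Fin (d N) → Bool, ε / 5 := by
            gcongr with t; exact h2 t
        _ = 2 ^ d N * (14 * (ε / 5)) := by
            simp; ring
        _ ≤ 2 ^ d N * (3 * ε) := by
            refine mul_le_mul_right ?_ _
            rw [← mul_div_assoc]
            refine ENNReal.div_le_of_le_mul ?_
            calc 14 * ε ≤ 15 * ε := by gcongr; norm_num
              _ = 3 * ε * 5 := by ring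
        _ = _ := by push_cast; ring
    refine (ENNReal.mul_le_mul_iff_right ?_ ?_).1 h3
    · simp
    · exact ENNReal.natCast_ne_top _
  · intro ω hω _
    refine (three_mul_two_pow_le_card_signVec (X N ω)).trans ?_
    gcongr 14 * ?_
    refine Finset.card_le_card ?_
    intro t ht
    simp only [Finset.mem_filter, Finset.mem_univ, true_and, B, Set.mem_ofPred_eq] at ht ⊢
    obtain ⟨q1, -, q3⟩ := hq N hN t
    have hval : ‖(WithLp.toLp 2 (X N ω ᵥ* V N t) : EuclideanSpace ℝ (Fin 1))‖ =
        |signVec t ⬝ᵥ X N ω| / √(q N t) := by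
      rw [EuclideanSpace.norm_eq]
      simp only [Finset.univ_unique, Finset.sum_singleton, Real.sqrt_sq (norm_nonneg _)]
      simp only [Real.norm_eq_abs, Matrix.vecMul, dotProduct, V, Matrix.of_apply, mul_div_assoc']
      rw [← Finset.sum_div, abs_div, abs_of_nonneg (Real.sqrt_nonneg (q N t))]
      simp only [mul_comm]
    rw [hval, le_div_iff₀ (Real.sqrt_pos.2 q1)]
    refine le_trans ?_ ht
    have hω' : (2 * √K * M + 1) * √(d N) ≤ eucNorm (X N ω) := hω
    have hK : 0 ≤ K := by
      have : 0 < K * d N := q1.trans_le q3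
      exact (pos_of_mul_pos_left this (by positivity)).le
    have hsq : √(q N t) ≤ √K * √(d N) := by
      rw [← Real.sqrt_mul hK]; exact Real.sqrt_le_sqrt q3
    have := mul_le_mul_of_nonneg_left hsq hM0
    have := Real.sqrt_nonneg (d N)
    linarith

end Tightness

/-! ### Measurability of unique solutions -/

/-- Projections of closed subsets of Euclidean space are σ-compact; this makes them Borel without
any theory of analytic sets. -/
lemma IsSigmaCompact.measurableSet {E : Type*} [TopologicalSpace E] [T2Space E]
    [MeasurableSpace E] [OpensMeasurableSpace E] {s : Set E} (hs : IsSigmaCompact s) :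
    MeasurableSet s := by
  obtain ⟨K, hK, rfl⟩ := hs
  exact MeasurableSet.iUnion fun k => (hK k).measurableSet

lemma uniqueSol_spec {l : ℕ} {S : (Fin l → ℝ) → Prop} {θ : Fin l → ℝ} (h : S θ)
    (huniq : ∀ θ', S θ' → θ' = θ) : uniqueSol S = θ := by
  have hex : ∃! θ, S θ := ⟨θ, h, huniq⟩
  rw [uniqueSol, dif_pos hex]
  exact huniq _ hex.choose_spec.1

/-- If `{(g, θ) | S g θ}` is closed, the unique solution `θ` of `S g θ` (or `0`) is a Borel
function of `g`. -/
lemma measurable_uniqueSol {l n : ℕ} (S : (Fin n → ℝ) → (Fin l → ℝ) → Prop)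
    (hS : IsClosed {p : (Fin n → ℝ) × (Fin l → ℝ) | S p.1 p.2}) :
    Measurable fun g => uniqueSol (S g) := by
  have hproj : ∀ F : Set (Fin l → ℝ), IsClosed F →
      MeasurableSet {g | ∃ θ ∈ F, S g θ} := by
    intro F hF
    have : IsSigmaCompact (Prod.fst '' ({p : (Fin n → ℝ) × (Fin l → ℝ) | S p.1 p.2} ∩
        Prod.snd ⁻¹' F)) :=
      (isSigmaCompact_univ.of_isClosed_subset (hS.inter (hF.preimage continuous_snd))
        (Set.subset_univ _)).image continuous_fst
    convert this.measurableSet using 1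
    ext g
    simp only [Set.mem_ofPred_eq, Set.mem_image, Set.mem_inter_iff, Set.mem_preimage]
    exact ⟨fun ⟨θ, h1, h2⟩ => ⟨(g, θ), ⟨h2, h1⟩, rfl⟩,
      fun ⟨p, ⟨h1, h2⟩, h3⟩ => h3 ▸ ⟨p.2, h2, h1⟩⟩
  -- Two distinct solutions are at distance at least `1 / (k + 1)` for some `k`, which turns
  -- non-uniqueness into a countable union of projections of closed sets.
  have hmany : MeasurableSet {g | ∃ θ₁ θ₂, θ₁ ≠ θ₂ ∧ S g θ₁ ∧ S g θ₂} := by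
    have hk : ∀ k : ℕ, IsSigmaCompact ((fun p : (Fin n → ℝ) × (Fin l → ℝ) × (Fin l → ℝ) => p.1) ''
        {p | S p.1 p.2.1 ∧ S p.1 p.2.2 ∧ 1 / ((k : ℝ) + 1) ≤ dist p.2.1 p.2.2}) := by
      intro k
      refine (isSigmaCompact_univ.of_isClosed_subset ?_ (Set.subset_univ _)).image continuous_fst
      refine IsClosed.inter ?_ (IsClosed.inter ?_ ?_)
      · exact hS.preimage (continuous_fst.prodMk (continuous_fst.comp continuous_snd))
      · exact hS.preimage (continuous_fst.prodMk (continuous_snd.comp continuous_snd))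
      · exact isClosed_le continuous_const
          ((continuous_fst.comp continuous_snd).dist (continuous_snd.comp continuous_snd))
    convert MeasurableSet.iUnion fun k => (hk k).measurableSet using 1
    ext g
    simp only [Set.mem_ofPred_eq, Set.mem_iUnion, Set.mem_image]
    constructor
    · rintro ⟨θ₁, θ₂, hne, h1, h2⟩
      obtain ⟨k, hk⟩ := exists_nat_one_div_lt (dist_pos.2 hne)
      exact ⟨k, (g, θ₁, θ₂), ⟨h1, h2, hk.le⟩, rfl⟩
    · rintro ⟨k, p, ⟨h1, h2, h3⟩, rfl⟩
      refine ⟨p.2.1, p.2.2, fun h => ?_, h1, h2⟩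
      rw [h, dist_self] at h3
      exact absurd h3 (not_le.2 (by positivity))
  have hU : MeasurableSet {g | ∃! θ, S g θ} := by
    convert (hproj Set.univ isClosed_univ).diff hmany using 1
    ext g
    simp only [Set.mem_ofPred_eq, Set.mem_sdiff, Set.mem_univ, true_and]
    constructor
    · rintro ⟨θ, h1, h2⟩
      exact ⟨⟨θ, h1⟩, fun ⟨a, b, hne, ha, hb⟩ => hne ((h2 a ha).trans (h2 b hb).symm)⟩
    · rintro ⟨⟨θ, h1⟩, h2⟩
      exact ⟨θ, h1, fun θ' h' => by_contra fun hne => h2 ⟨θ', θ, hne, h', h1⟩⟩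
  refine measurable_of_isClosed fun F hF => ?_
  -- Either the solution is unique and some solution lies in `F`, or the default value 0 is taken.
  have : (fun g => uniqueSol (S g)) ⁻¹' F =
      ({g | ∃! θ, S g θ} ∩ {g | ∃ θ ∈ F, S g θ}) ∪
        ({g | ∃! θ, S g θ}ᶜ ∩ {_g | (0 : Fin l → ℝ) ∈ F}) := by
    ext g
    simp only [Set.mem_preimage, Set.mem_union, Set.mem_inter_iff, Set.mem_ofPred_eq,
      Set.mem_compl_iff]
    by_cases hg : ∃! θ, S g θ
    · obtain ⟨θ, h1, h2⟩ := hg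
      rw [uniqueSol_spec h1 h2]
      refine ⟨fun h => Or.inl ⟨⟨θ, h1, h2⟩, θ, h, h1⟩, ?_⟩
      rintro (⟨-, θ', h3, h4⟩ | ⟨h3, -⟩)
      · rwa [← h2 θ' h4]
      · exact absurd ⟨θ, h1, h2⟩ h3
    · rw [uniqueSol, dif_neg hg]
      simp [hg]
  rw [this]
  exact (hU.inter (hproj F hF)).union (hU.compl.inter (MeasurableSet.const _))

/-! ### Weighted and total least squares -/

lemma isOLS_eq_isWLS_one {m l : ℕ} (Φ : Matrix (Fin m) (Fin l) ℝ) (z : Fin m → ℝ) :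
    IsOLS Φ z = IsWLS 1 Φ z := by
  ext θ
  simp [IsOLS, IsWLS]

lemma dotProduct_transpose_mulVec {m l : ℕ} (Φ : Matrix (Fin m) (Fin l) ℝ) (v : Fin l → ℝ)
    (r : Fin m → ℝ) : v ⬝ᵥ (Φᵀ *ᵥ r) = (Φ *ᵥ v) ⬝ᵥ r := by
  rw [Matrix.mulVec_transpose, dotProduct_comm, ← Matrix.dotProduct_mulVec, dotProduct_comm]

lemma eq_zero_of_dotProduct_self_le_zero {l : ℕ} {v : Fin l → ℝ} (h : v ⬝ᵥ v ≤ 0) : v = 0 :=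
  dotProduct_self_eq_zero.1 (le_antisymm h (dotProduct_self_nonneg' v))

/-- A coercive matrix is invertible. -/
lemma isUnit_of_coercive {l : ℕ} {G : Matrix (Fin l) (Fin l) ℝ} {κ : ℝ} (hκ : 0 < κ)
    (hG : ∀ v, κ * (v ⬝ᵥ v) ≤ v ⬝ᵥ (G *ᵥ v)) : IsUnit G := by
  rw [← Matrix.mulVec_injective_iff_isUnit]
  intro x y hxy
  have h0 : G *ᵥ (x - y) = 0 := by rw [Matrix.mulVec_sub]; exact sub_eq_zero.2 hxy
  have h := hG (x - y)
  rw [h0, dotProduct_zero] at h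
  exact sub_eq_zero.1 (eq_zero_of_dotProduct_self_le_zero (by nlinarith))

/-- The quadratic expansion of the weighted residual. -/
lemma weighted_residual_expand {m l : ℕ} {W : Matrix (Fin m) (Fin m) ℝ} (hW : Wᵀ = W)
    (Φ : Matrix (Fin m) (Fin l) ℝ) (z : Fin m → ℝ) (θ d : Fin l → ℝ) :
    (z - Φ *ᵥ (θ + d)) ⬝ᵥ (W *ᵥ (z - Φ *ᵥ (θ + d))) =
      (z - Φ *ᵥ θ) ⬝ᵥ (W *ᵥ (z - Φ *ᵥ θ)) - 2 * (d ⬝ᵥ (Φᵀ *ᵥ (W *ᵥ (z - Φ *ᵥ θ)))) +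
        (Φ *ᵥ d) ⬝ᵥ (W *ᵥ (Φ *ᵥ d)) := by
  have h1 : z - Φ *ᵥ (θ + d) = (z - Φ *ᵥ θ) - Φ *ᵥ d := by rw [Matrix.mulVec_add]; abel
  have h2 : (z - Φ *ᵥ θ) ⬝ᵥ (W *ᵥ (Φ *ᵥ d)) = (Φ *ᵥ d) ⬝ᵥ (W *ᵥ (z - Φ *ᵥ θ)) := by
    conv_lhs => rw [← hW]
    rw [dotProduct_transpose_mulVec, dotProduct_comm]
  rw [h1, dotProduct_transpose_mulVec]
  generalize z - Φ *ᵥ θ = r at h2 ⊢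
  rw [Matrix.mulVec_sub, dotProduct_sub, sub_dotProduct, sub_dotProduct, h2]
  ring

/-- Around a solution of the normal equations the objective is a constant plus a coercive quadratic
form. The minimizer thus exists and is unique, and the default value of `uniqueSol` does not
intervene. -/
lemma mulVec_uniqueSol_isWLS {m l : ℕ} {W : Matrix (Fin m) (Fin m) ℝ} (hW : Wᵀ = W)
    {Φ : Matrix (Fin m) (Fin l) ℝ} (z : Fin m → ℝ) {κ : ℝ} (hκ : 0 < κ)
    (hG : ∀ v, κ * (v ⬝ᵥ v) ≤ v ⬝ᵥ ((Φᵀ * W * Φ) *ᵥ v)) :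
    (Φᵀ * W * Φ) *ᵥ uniqueSol (IsWLS W Φ z) = Φᵀ *ᵥ (W *ᵥ z) := by
  have hunit := isUnit_of_coercive hκ hG
  obtain ⟨θ, hθ⟩ := (Matrix.mulVec_surjective_iff_isUnit.2 hunit) (Φᵀ *ᵥ (W *ᵥ z))
  have hr : Φᵀ *ᵥ (W *ᵥ (z - Φ *ᵥ θ)) = 0 := by
    rw [Matrix.mulVec_sub, Matrix.mulVec_sub, ← hθ]
    simp [Matrix.mulVec_mulVec, Matrix.mul_assoc]
  have hq : ∀ d, (z - Φ *ᵥ (θ + d)) ⬝ᵥ (W *ᵥ (z - Φ *ᵥ (θ + d))) =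
      (z - Φ *ᵥ θ) ⬝ᵥ (W *ᵥ (z - Φ *ᵥ θ)) + d ⬝ᵥ ((Φᵀ * W * Φ) *ᵥ d) := by
    intro d
    rw [weighted_residual_expand hW, hr, ← Matrix.mulVec_mulVec, ← Matrix.mulVec_mulVec,
      dotProduct_transpose_mulVec]
    simp
  rw [uniqueSol_spec (θ := θ), hθ]
  · intro θ'
    have h1 := hq (θ' - θ)
    rw [add_sub_cancel] at h1
    have := hG (θ' - θ)
    have := mul_nonneg hκ.le (dotProduct_self_nonneg' (θ' - θ))
    linarith
  · intro θ' h
    have h1 := hq (θ' - θ)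
    rw [add_sub_cancel] at h1
    have h2 := h θ
    have h3 := hG (θ' - θ)
    exact sub_eq_zero.1 (eq_zero_of_dotProduct_self_le_zero (by nlinarith))

/-- A vector is a total least-squares solution iff it minimizes the normalized residual. -/
lemma isTLS_iff {m l : ℕ} (Φ : Matrix (Fin m) (Fin l) ℝ) (z : Fin m → ℝ) (θ : Fin l → ℝ) :
    IsTLS Φ z θ ↔ ∀ θ', ((z - Φ *ᵥ θ) ⬝ᵥ (z - Φ *ᵥ θ)) / (1 + θ ⬝ᵥ θ) ≤
      ((z - Φ *ᵥ θ') ⬝ᵥ (z - Φ *ᵥ θ')) / (1 + θ' ⬝ᵥ θ') := by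
  have hpos : ∀ η : Fin l → ℝ, 0 < 1 + η ⬝ᵥ η := fun η => by
    linarith [dotProduct_self_nonneg' η]
  -- The residual is `[E e]` applied to `(η, -1)`, a vector of squared norm `1 + η ⬝ᵥ η`;
  -- Cauchy–Schwarz is applied row by row.
  have hlow : ∀ E e (η : Fin l → ℝ), (Φ + E) *ᵥ η = z + e →
      ((z - Φ *ᵥ η) ⬝ᵥ (z - Φ *ᵥ η)) / (1 + η ⬝ᵥ η) ≤ frobSq E e := by
    intro E e η h
    rw [div_le_iff₀ (hpos η)]
    have hr : z - Φ *ᵥ η = E *ᵥ η - e := by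
      rw [Matrix.add_mulVec] at h
      rw [sub_eq_sub_iff_add_eq_add, ← h, add_comm]
    rw [hr, frobSq, ← Finset.sum_add_distrib, Finset.sum_mul, dotProduct]
    refine Finset.sum_le_sum fun i _ => ?_
    have hcs := Finset.sum_mul_sq_le_sq_mul_sq Finset.univ (E i) η
    have hη : ∑ j, η j ^ 2 = η ⬝ᵥ η := by simp [dotProduct, sq]
    rw [hη] at hcs
    have hs : 0 ≤ ∑ j, E i j ^ 2 := Finset.sum_nonneg fun j _ => sq_nonneg _
    have hx : (E *ᵥ η - e) i = ∑ j, E i j * η j - e i := rfl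
    rw [hx]
    set x := ∑ j, E i j * η j
    set s := ∑ j, E i j ^ 2
    set q := η ⬝ᵥ η
    have hq : 0 ≤ q := dotProduct_self_nonneg' η
    rcases hq.eq_or_lt with h0 | h0
    · have : x ^ 2 ≤ 0 := by rw [← h0] at hcs; simpa using hcs
      have hx0 : x = 0 := by nlinarith
      rw [hx0, ← h0]; nlinarith
    · have h1 : 0 ≤ (x + q * e i) ^ 2 := sq_nonneg _
      have h2 : 0 ≤ (x ^ 2 + 2 * q * (x * e i) + q ^ 2 * e i ^ 2) / q := by
        refine div_nonneg ?_ h0.le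
        nlinarith
      have h3 : (x ^ 2 + 2 * q * (x * e i) + q ^ 2 * e i ^ 2) / q =
          x ^ 2 / q + 2 * (x * e i) + q * e i ^ 2 := by
        field_simp
      have h4 : x ^ 2 / q ≤ s := by rw [div_le_iff₀ h0]; exact hcs
      rw [h3] at h2
      nlinarith
  -- Equality in Cauchy–Schwarz is attained by the rank-one perturbation `r (η, -1)ᵀ / (1 + η ⬝ᵥ
  -- η)`, with `r` the residual.
  have hatt : ∀ η : Fin l → ℝ, ∃ E e, (Φ + E) *ᵥ η = z + e ∧
      frobSq E e = ((z - Φ *ᵥ η) ⬝ᵥ (z - Φ *ᵥ η)) / (1 + η ⬝ᵥ η) := by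
    intro η
    have hne := (hpos η).ne'
    refine ⟨Matrix.of fun i j => (z - Φ *ᵥ η) i * η j / (1 + η ⬝ᵥ η),
      fun i => -(z - Φ *ᵥ η) i / (1 + η ⬝ᵥ η), ?_, ?_⟩
    · ext i
      have : (Matrix.of (fun i j => (z - Φ *ᵥ η) i * η j / (1 + η ⬝ᵥ η)) *ᵥ η) i =
          (z - Φ *ᵥ η) i * (η ⬝ᵥ η) / (1 + η ⬝ᵥ η) := by
        simp only [Matrix.mulVec, dotProduct, Matrix.of_apply, Finset.mul_sum, Finset.sum_div]
        exact Finset.sum_congr rfl fun j _ => by ring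
      rw [Matrix.add_mulVec, Pi.add_apply, this, Pi.add_apply, Pi.sub_apply]
      field_simp
      ring
    · have h1 : ∀ i, ∑ j, ((z - Φ *ᵥ η) i * η j / (1 + η ⬝ᵥ η)) ^ 2 =
          ((z - Φ *ᵥ η) i) ^ 2 * (η ⬝ᵥ η) / (1 + η ⬝ᵥ η) ^ 2 := by
        intro i
        generalize 1 + η ⬝ᵥ η = s
        rw [dotProduct, Finset.mul_sum, Finset.sum_div]
        exact Finset.sum_congr rfl fun j _ => by ring
      have h2 : ∀ r : Fin m → ℝ, r ⬝ᵥ r / (1 + η ⬝ᵥ η) = ∑ i, r i * r i / (1 + η ⬝ᵥ η) :=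
        fun r => Finset.sum_div _ _ _
      simp only [frobSq, Matrix.of_apply, h1]
      rw [← Finset.sum_add_distrib, h2]
      refine Finset.sum_congr rfl fun i _ => ?_
      field_simp
      ring
  constructor
  · rintro ⟨E, e, hmin, h⟩ θ'
    obtain ⟨E', e', h1, h2⟩ := hatt θ'
    exact (hlow E e θ h).trans ((hmin E' e' ⟨θ', h1⟩).trans h2.le)
  · intro h
    obtain ⟨E, e, h1, h2⟩ := hatt θ
    refine ⟨E, e, fun E' e' ⟨θ', h'⟩ => ?_, h1⟩
    rw [h2]
    exact (h θ').trans (hlow E' e' θ' h')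

lemma continuous_normalized_residual {m l : ℕ} (Φ : Matrix (Fin m) (Fin l) ℝ) (z : Fin m → ℝ) :
    Continuous fun θ : Fin l → ℝ => ((z - Φ *ᵥ θ) ⬝ᵥ (z - Φ *ᵥ θ)) / (1 + θ ⬝ᵥ θ) := by
  have hr : Continuous fun θ : Fin l → ℝ => z - Φ *ᵥ θ :=
    continuous_const.sub (Continuous.matrix_mulVec continuous_const continuous_id)
  refine (hr.dotProduct hr).div (continuous_const.add (continuous_id.dotProduct continuous_id))
    fun θ => ?_
  have := dotProduct_self_nonneg' θ
  positivity

/-- By coercivity the normalized residual of a distant `θ` exceeds `κ / 8`, hence its value at `a`;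
a continuous function with this behaviour attains its minimum. -/
lemma exists_min_normalized_residual {m l : ℕ} {Φ : Matrix (Fin m) (Fin l) ℝ} {z : Fin m → ℝ}
    {κ : ℝ} (hκ : 0 < κ) (hG : ∀ v, κ * (v ⬝ᵥ v) ≤ (Φ *ᵥ v) ⬝ᵥ (Φ *ᵥ v)) (a : Fin l → ℝ)
    (hr : (z - Φ *ᵥ a) ⬝ᵥ (z - Φ *ᵥ a) ≤ κ / 8) :
    ∃ θ : Fin l → ℝ, ∀ θ', ((z - Φ *ᵥ θ) ⬝ᵥ (z - Φ *ᵥ θ)) / (1 + θ ⬝ᵥ θ) ≤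
      ((z - Φ *ᵥ θ') ⬝ᵥ (z - Φ *ᵥ θ')) / (1 + θ' ⬝ᵥ θ') := by
  refine (continuous_normalized_residual Φ z).exists_forall_le' a ?_
  have hcoc : Tendsto (fun θ : Fin l → ℝ => ‖θ‖) (cocompact _) atTop :=
    tendsto_norm_cocompact_atTop
  filter_upwards [hcoc.eventually_ge_atTop (1 + 4 * (a ⬝ᵥ a) + 2)] with θ hθ
  have ha := dotProduct_self_nonneg' a
  have hr0 := dotProduct_self_nonneg' (z - Φ *ᵥ a)
  have hθ0 := dotProduct_self_nonneg' θ
  have hsq : ‖θ‖ ≤ θ ⬝ᵥ θ := by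
    have h1 : ‖θ‖ ≤ eucNorm θ := by
      refine (pi_norm_le_iff_of_nonneg (norm_nonneg _)).2 fun i => ?_
      exact PiLp.norm_apply_le (WithLp.toLp 2 θ) i
    rw [← eucNorm_sq]
    nlinarith
  calc ((z - Φ *ᵥ a) ⬝ᵥ (z - Φ *ᵥ a)) / (1 + a ⬝ᵥ a)
      ≤ (z - Φ *ᵥ a) ⬝ᵥ (z - Φ *ᵥ a) := div_le_self hr0 (by linarith)
    _ ≤ _ := by
      rw [le_div_iff₀ (by linarith)]
      have hd : θ = a + (θ - a) := by abel
      set d := θ - a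
      set r := z - Φ *ᵥ a
      have h1 : z - Φ *ᵥ θ = r - Φ *ᵥ d := by
        rw [hd, Matrix.mulVec_add]; simp only [r]; abel
      have h2 : (Φ *ᵥ d) ⬝ᵥ (Φ *ᵥ d) ≤ 2 * ((r - Φ *ᵥ d) ⬝ᵥ (r - Φ *ᵥ d)) + 2 * (r ⬝ᵥ r) := by
        have := dotProduct_self_nonneg' ((r - Φ *ᵥ d) + r)
        simp only [add_dotProduct, dotProduct_add, sub_dotProduct, dotProduct_sub,
          dotProduct_comm (Φ *ᵥ d) r] at this ⊢
        linarith
      have h3 : θ ⬝ᵥ θ ≤ 2 * (d ⬝ᵥ d) + 2 * (a ⬝ᵥ a) := by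
        have := dotProduct_self_nonneg' (d - a)
        rw [hd]
        simp only [add_dotProduct, dotProduct_add, sub_dotProduct, dotProduct_sub,
          dotProduct_comm d a] at this ⊢
        linarith
      have h4 := hG d
      rw [h1]
      nlinarith

/-- The normal equations of total least squares. -/
lemma mulVec_uniqueSol_isTLS {m l : ℕ} {Φ : Matrix (Fin m) (Fin l) ℝ} {z : Fin m → ℝ}
    {κ : ℝ} (hκ : 0 < κ) (hG : ∀ v, κ * (v ⬝ᵥ v) ≤ (Φ *ᵥ v) ⬝ᵥ (Φ *ᵥ v)) (a : Fin l → ℝ)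
    (hr : (z - Φ *ᵥ a) ⬝ᵥ (z - Φ *ᵥ a) ≤ κ / 8) :
    ∃ c, 0 ≤ c ∧ c ≤ (z - Φ *ᵥ a) ⬝ᵥ (z - Φ *ᵥ a) ∧
      (Φᵀ * Φ) *ᵥ uniqueSol (IsTLS Φ z) - c • uniqueSol (IsTLS Φ z) = Φᵀ *ᵥ z := by
  obtain ⟨θ, hθ⟩ := exists_min_normalized_residual hκ hG a hr
  have hpos : ∀ η : Fin l → ℝ, 0 < 1 + η ⬝ᵥ η := fun η => by
    linarith [dotProduct_self_nonneg' η]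
  set c := ((z - Φ *ᵥ θ) ⬝ᵥ (z - Φ *ᵥ θ)) / (1 + θ ⬝ᵥ θ) with hc
  have hc0 : 0 ≤ c := div_nonneg (dotProduct_self_nonneg' _) (hpos θ).le
  have hca : c ≤ (z - Φ *ᵥ a) ⬝ᵥ (z - Φ *ᵥ a) :=
    (hθ a).trans (div_le_self (dotProduct_self_nonneg' _) (by
      linarith [dotProduct_self_nonneg' a]))
  have hF : ∀ η, c * (1 + η ⬝ᵥ η) ≤ (z - Φ *ᵥ η) ⬝ᵥ (z - Φ *ᵥ η) := fun η => by
    rw [← le_div_iff₀ (hpos η)]; exact hθ η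
  have hF0 : (z - Φ *ᵥ θ) ⬝ᵥ (z - Φ *ᵥ θ) = c * (1 + θ ⬝ᵥ θ) := by
    rw [hc, div_mul_cancel₀ _ (hpos θ).ne']
  -- Multiplying out the quotient, `θ` minimizes the quadratic function `‖z - Φ η‖² - c (1 + ‖η‖²)`,
  -- whose minimum is 0; this is its expansion at `θ`.
  have hexp : ∀ d, (z - Φ *ᵥ (θ + d)) ⬝ᵥ (z - Φ *ᵥ (θ + d)) - c * (1 + (θ + d) ⬝ᵥ (θ + d)) =
      -2 * (d ⬝ᵥ (Φᵀ *ᵥ (z - Φ *ᵥ θ) + c • θ)) + ((Φ *ᵥ d) ⬝ᵥ (Φ *ᵥ d) - c * (d ⬝ᵥ d)) := by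
    intro d
    have h := weighted_residual_expand (W := 1) (by simp) Φ z θ d
    simp only [Matrix.one_mulVec] at h
    rw [h, hF0]
    simp only [add_dotProduct, dotProduct_add, dotProduct_smul, smul_eq_mul, dotProduct_comm θ d]
    ring
  have hgrad : Φᵀ *ᵥ (z - Φ *ᵥ θ) + c • θ = 0 := by
    set w := Φᵀ *ᵥ (z - Φ *ᵥ θ) + c • θ
    -- Along the gradient direction `w` the function is a quadratic in `t` with no constant term and
    -- linear coefficient `-2 ‖w‖²`. Being nonnegative, it forces `w = 0`.
    have hdisc := discrim_le_zero (a := (Φ *ᵥ w) ⬝ᵥ (Φ *ᵥ w) - c * (w ⬝ᵥ w))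
      (b := -2 * (w ⬝ᵥ w)) (c := 0) fun t => by
        have h1 := hexp (t • w)
        have h2 := hF (θ + t • w)
        simp only [Matrix.mulVec_smul, smul_dotProduct, dotProduct_smul, smul_eq_mul] at h1
        linarith
    rw [discrim] at hdisc
    have : (w ⬝ᵥ w) ^ 2 ≤ 0 := by nlinarith
    have h0 : w ⬝ᵥ w = 0 := by nlinarith [dotProduct_self_nonneg' w]
    exact dotProduct_self_eq_zero.1 h0
  -- Since `c ≤ κ / 8`, the quadratic part `‖Φ d‖² - c ‖d‖²` is positive definite, so there is no
  -- second minimizer.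
  have huniq : uniqueSol (IsTLS Φ z) = θ := by
    refine uniqueSol_spec ((isTLS_iff _ _ _).2 hθ) fun θ' h' => ?_
    have h1 := (isTLS_iff _ _ _).1 h' θ
    rw [div_le_iff₀ (hpos θ'), ← hc] at h1
    have h2 := hexp (θ' - θ)
    rw [add_sub_cancel, hgrad, dotProduct_zero] at h2
    have h3 := hG (θ' - θ)
    have h4 := dotProduct_self_nonneg' (θ' - θ)
    exact sub_eq_zero.1 (eq_zero_of_dotProduct_self_le_zero (by nlinarith))
  refine ⟨c, hc0, hca, ?_⟩
  rw [huniq, ← Matrix.mulVec_mulVec]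
  rw [Matrix.mulVec_sub] at hgrad
  have := congrArg (fun v => Φᵀ *ᵥ z - v) hgrad
  simp only [sub_zero] at this
  rw [← this]
  abel

/-! ### The estimates are Borel functions of the Markov parameters -/

lemma continuous_hankel_residual (nx n : ℕ) (θ : (Fin n → ℝ) × (Fin nx → ℝ) → Fin nx → ℝ)
    (hθ : Continuous θ) :
    Continuous fun p : (Fin n → ℝ) × (Fin nx → ℝ) =>
      -hankelBot nx p.1 - (hankelTop nx p.1)ᵀ *ᵥ θ p := by
  have h1 : Continuous fun p : (Fin n → ℝ) × (Fin nx → ℝ) => hankelBot nx p.1 :=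
    by
    refine continuous_pi fun j => ?_
    simp only [hankelBot, hankel, Matrix.of_apply]
    fun_prop
  have h2 : Continuous fun p : (Fin n → ℝ) × (Fin nx → ℝ) => (hankelTop nx p.1)ᵀ :=
    by
    refine continuous_matrix fun i j => ?_
    simp only [hankelTop, hankel, Matrix.of_apply, Matrix.transpose_apply]
    fun_prop
  exact h1.neg.sub (h2.matrix_mulVec hθ)

lemma measurable_aWLS (nx n : ℕ) (W : Matrix (Fin (n - nx)) (Fin (n - nx)) ℝ) :
    Measurable (aWLS nx W) := by
  refine measurable_uniqueSol (fun g => IsWLS W (hankelTop nx g)ᵀ (-hankelBot nx g)) ?_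
  simp only [IsWLS, Set.ofPred_forall]
  refine isClosed_iInter fun θ' => ?_
  have h1 := continuous_hankel_residual nx n _ continuous_snd
  have h2 := continuous_hankel_residual nx n _ (continuous_const (y := θ'))
  exact isClosed_le (h1.dotProduct (Continuous.matrix_mulVec continuous_const h1))
    (h2.dotProduct (Continuous.matrix_mulVec continuous_const h2))

lemma aOLS_eq_aWLS_one (nx n : ℕ) : aOLS nx (n := n) = aWLS nx 1 := by
  ext1 g
  rw [aOLS, aWLS, isOLS_eq_isWLS_one]

lemma measurable_aTLS (nx n : ℕ) : Measurable (aTLS nx (n := n)) := by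
  refine measurable_uniqueSol (fun g => IsTLS (hankelTop nx g)ᵀ (-hankelBot nx g)) ?_
  simp only [isTLS_iff, Set.ofPred_forall]
  refine isClosed_iInter fun θ' => ?_
  have h1 := continuous_hankel_residual nx n _ continuous_snd
  have h2 := continuous_hankel_residual nx n _ (continuous_const (y := θ'))
  have hne : ∀ θ : Fin nx → ℝ, 1 + θ ⬝ᵥ θ ≠ 0 := fun θ => by
    have := dotProduct_self_nonneg' θ
    positivity
  exact isClosed_le ((h1.dotProduct h1).div
    (continuous_const.add (continuous_snd.dotProduct continuous_snd)) fun p => hne _)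
    ((h2.dotProduct h2).div_const _)

/-! ### Operator norms and perturbed normal equations -/

section OperatorNorm
open scoped Matrix.Norms.L2Operator

variable {m l : ℕ}

lemma eucNorm_mulVec_le (A : Matrix (Fin m) (Fin l) ℝ) (v : Fin l → ℝ) :
    eucNorm (A *ᵥ v) ≤ ‖A‖ * eucNorm v :=
  Matrix.l2_opNorm_mulVec A (WithLp.toLp 2 v)

lemma l2_opNorm_transpose (A : Matrix (Fin m) (Fin l) ℝ) : ‖Aᵀ‖ = ‖A‖ := by
  rw [← Matrix.conjTranspose_eq_transpose_of_trivial, Matrix.l2_opNorm_conjTranspose]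

lemma l2_opNorm_le_of_eucNorm_le {A : Matrix (Fin m) (Fin l) ℝ} {R : ℝ} (hR : 0 ≤ R)
    (h : ∀ v, eucNorm (A *ᵥ v) ≤ R * eucNorm v) : ‖A‖ ≤ R := by
  rw [Matrix.l2_opNorm_def]
  exact ContinuousLinearMap.opNorm_le_bound _ hR fun x => h (WithLp.ofLp x)

/-- A coercive matrix bounds norms from below. -/
lemma mul_eucNorm_le_of_coercive {G : Matrix (Fin l) (Fin l) ℝ} {κ : ℝ}
    (hG : ∀ v, κ * (v ⬝ᵥ v) ≤ v ⬝ᵥ (G *ᵥ v)) (v : Fin l → ℝ) :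
    κ * eucNorm v ≤ eucNorm (G *ᵥ v) := by
  rcases (norm_nonneg (WithLp.toLp 2 v)).eq_or_lt with h0 | h0
  · rw [eucNorm, ← h0, mul_zero]; positivity
  · have h1 := hG v
    have h2 := (le_abs_self _).trans (abs_dotProduct_le v (G *ᵥ v))
    rw [← eucNorm_sq] at h1
    refine le_of_mul_le_mul_left ?_ h0
    nlinarith

lemma l2_opNorm_inv_le_of_coercive {G : Matrix (Fin l) (Fin l) ℝ} {κ : ℝ} (hκ : 0 < κ)
    (hG : ∀ v, κ * (v ⬝ᵥ v) ≤ v ⬝ᵥ (G *ᵥ v)) : ‖G⁻¹‖ ≤ κ⁻¹ := by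
  refine l2_opNorm_le_of_eucNorm_le (by positivity) fun v => ?_
  have h := mul_eucNorm_le_of_coercive hG (G⁻¹ *ᵥ v)
  rw [Matrix.mulVec_mulVec, Matrix.mul_nonsing_inv _
    ((Matrix.isUnit_iff_isUnit_det G).1 (isUnit_of_coercive hκ hG)), Matrix.one_mulVec] at h
  rwa [inv_mul_eq_div, le_div_iff₀' hκ]

lemma dotProduct_mulVec_le_opNorm (A : Matrix (Fin l) (Fin l) ℝ) (v : Fin l → ℝ) :
    |v ⬝ᵥ (A *ᵥ v)| ≤ ‖A‖ * (v ⬝ᵥ v) := by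
  refine (abs_dotProduct_le _ _).trans ?_
  rw [← eucNorm_sq, sq, ← mul_assoc, mul_comm ‖A‖, mul_assoc]
  gcongr
  exact eucNorm_mulVec_le A v

lemma opNorm_gram_sub_gram_le {H Hh : Matrix (Fin l) (Fin m) ℝ} {W : Matrix (Fin m) (Fin m) ℝ}
    {R η : ℝ} (hR : 0 ≤ R) (hH : ‖H‖ ≤ R) (hHh : ‖Hh‖ ≤ 2 * R) (hW : ‖W‖ ≤ R)
    (hd : ‖H - Hh‖ ≤ η) : ‖H * W * Hᵀ - Hh * W * Hhᵀ‖ ≤ 3 * R ^ 2 * η := by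
  have h : H * W * Hᵀ - Hh * W * Hhᵀ = (H - Hh) * W * Hᵀ + Hh * W * (H - Hh)ᵀ := by
    rw [Matrix.transpose_sub, Matrix.sub_mul, Matrix.sub_mul, Matrix.mul_sub]; abel
  have hη : 0 ≤ η := (norm_nonneg _).trans hd
  rw [h]
  refine (norm_add_le _ _).trans ?_
  have h1 : ‖(H - Hh) * W * Hᵀ‖ ≤ η * R * R := by
    refine (Matrix.l2_opNorm_mul _ _).trans ?_
    rw [l2_opNorm_transpose]
    gcongr
    refine (Matrix.l2_opNorm_mul _ _).trans ?_
    gcongr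
  have h2 : ‖Hh * W * (H - Hh)ᵀ‖ ≤ 2 * R * R * η := by
    refine (Matrix.l2_opNorm_mul _ _).trans ?_
    rw [l2_opNorm_transpose]
    gcongr
    refine (Matrix.l2_opNorm_mul _ _).trans ?_
    gcongr
  linarith

/-- Linearization of the solution of perturbed normal equations, with constants that do not
depend on the dimensions. -/
lemma exists_linearization_constants (R κ : ℝ) (hR : 0 ≤ R) (hκ : 0 < κ) :
    ∃ C δ₀ : ℝ, 0 ≤ C ∧ 0 < δ₀ ∧ R ^ 2 * δ₀ ^ 2 ≤ κ / 16 ∧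
      ∀ {m l : ℕ} (H Hh : Matrix (Fin l) (Fin m) ℝ) (W : Matrix (Fin m) (Fin m) ℝ) (δ : ℝ),
      ‖H‖ ≤ R → ‖W‖ ≤ R → (∀ v, κ * (v ⬝ᵥ v) ≤ v ⬝ᵥ ((H * W * Hᵀ) *ᵥ v)) →
      0 ≤ δ → δ ≤ δ₀ → ‖H - Hh‖ ≤ R * δ →
      (∀ v, κ / 2 * (v ⬝ᵥ v) ≤ v ⬝ᵥ ((Hh * W * Hhᵀ) *ᵥ v)) ∧
      ∀ (a D D₀ : Fin l → ℝ) (e : Fin m → ℝ) (c : ℝ), eucNorm a ≤ R → eucNorm e ≤ R * δ →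
        |c| ≤ R ^ 2 * δ ^ 2 →
        (Hh * W * Hhᵀ) *ᵥ D - c • D = Hh *ᵥ (W *ᵥ e) + c • a →
        (H * W * Hᵀ) *ᵥ D₀ = H *ᵥ (W *ᵥ e) → eucNorm (D - D₀) ≤ C * δ ^ 2 := by
  -- A single constant dominating every power of `R` met below.
  set S := 3 * R ^ 3 + R ^ 2 + R + 1 with hS
  have hS1 : 1 ≤ S := by rw [hS]; linarith [pow_nonneg hR 3, pow_nonneg hR 2]
  have hR1 : R ^ 2 ≤ S := by linarith [pow_nonneg hR 3]
  have hR3 : 3 * R ^ 3 ≤ S := by linarith [pow_nonneg hR 2]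
  set C₁ := 2 / κ * S with hC₁
  have hC₁0 : 0 ≤ C₁ := by positivity
  refine ⟨κ⁻¹ * (S * (C₁ * S) + S + S * (C₁ * S) + S * S), min 1 (κ / (16 * S)), by positivity, by positivity,
    ?_, ?_⟩
  · have h1 : min 1 (κ / (16 * S)) ≤ 1 := min_le_left _ _
    have h2 : min 1 (κ / (16 * S)) ≤ κ / (16 * S) := min_le_right _ _
    have h3 : 0 < min 1 (κ / (16 * S)) := by positivity
    calc R ^ 2 * min 1 (κ / (16 * S)) ^ 2 ≤ S * (κ / (16 * S)) := by
          gcongr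
          nlinarith
      _ = κ / 16 := by field_simp
  intro m l H Hh W δ hH hW hG hδ0 hδ hHd
  have hδ1 : δ ≤ 1 := hδ.trans (min_le_left _ _)
  have hδ2 : S * δ ≤ κ / 16 := by
    have := mul_le_mul_of_nonneg_left (hδ.trans (min_le_right _ _)) (by linarith : 0 ≤ S)
    refine this.trans (le_of_eq ?_)
    field_simp
  have hHh : ‖Hh‖ ≤ 2 * R := by
    have : Hh = H - (H - Hh) := by abel
    rw [this]
    refine (norm_sub_le _ _).trans ?_
    nlinarith
  have hE : ‖H * W * Hᵀ - Hh * W * Hhᵀ‖ ≤ S * δ := by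
    refine (opNorm_gram_sub_gram_le hR hH hHh hW hHd).trans ?_
    calc 3 * R ^ 2 * (R * δ) = 3 * R ^ 3 * δ := by ring
      _ ≤ S * δ := by gcongr
  set E := H * W * Hᵀ - Hh * W * Hhᵀ with hEdef
  have hGE : Hh * W * Hhᵀ = H * W * Hᵀ - E := by rw [hEdef]; abel
  refine ⟨fun v => ?_, ?_⟩
  · rw [hGE, Matrix.sub_mulVec, dotProduct_sub]
    have h1 := (le_abs_self _).trans (dotProduct_mulVec_le_opNorm E v)
    have h2 := hG v
    have h3 := dotProduct_self_nonneg' v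
    nlinarith
  · intro a D D₀ e c ha he hc hD hD₀
    rw [hGE] at hD
    have hcS : |c| ≤ S * δ ^ 2 := hc.trans (by gcongr)
    have hWe : eucNorm (W *ᵥ e) ≤ R * (R * δ) :=
      (eucNorm_mulVec_le _ _).trans (by gcongr)
    have hk := norm_nonneg (WithLp.toLp 2 D)
    have hED : eucNorm (E *ᵥ D) ≤ S * δ * eucNorm D :=
      (eucNorm_mulVec_le _ _).trans (by gcongr)
    have hcD : eucNorm (c • (D + a)) ≤ S * δ ^ 2 * (eucNorm D + R) := by
      rw [eucNorm_smul]
      gcongr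
      exact (eucNorm_add_le _ _).trans (by gcongr)
    -- All perturbations are moved to the right-hand side, leaving the unperturbed Gram matrix on
    -- the left.
    have hGD : (H * W * Hᵀ) *ᵥ D = E *ᵥ D + Hh *ᵥ (W *ᵥ e) + c • (D + a) := by
      rw [Matrix.sub_mulVec] at hD
      rw [smul_add]
      have h1 : (H * W * Hᵀ) *ᵥ D = ((H * W * Hᵀ) *ᵥ D - E *ᵥ D - c • D) + E *ᵥ D + c • D := by
        abel
      rw [h1, hD]
      abel
    -- A priori bound `D = O(δ)`: the choice of `δ₀` bounds both `S δ` and `S δ²` by `κ / 16`, so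
    -- the terms containing `D` are absorbed on the left.
    have hDb : eucNorm D ≤ C₁ * (S * δ) := by
      have h1 := mul_eucNorm_le_of_coercive hG D
      have h2 : eucNorm (Hh *ᵥ (W *ᵥ e)) ≤ 2 * R * (R * (R * δ)) :=
        (eucNorm_mulVec_le _ _).trans (by gcongr)
      rw [hGD] at h1
      have h3 := (eucNorm_add_le (E *ᵥ D + Hh *ᵥ (W *ᵥ e)) (c • (D + a)))
      have h4 := (eucNorm_add_le (E *ᵥ D) (Hh *ᵥ (W *ᵥ e)))
      have h5 : S * δ ^ 2 ≤ S * δ := by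
        rw [sq, ← mul_assoc]; exact mul_le_of_le_one_right (by positivity) hδ1
      have h6 : S * δ ^ 2 * (eucNorm D + R) ≤ S * δ * (eucNorm D + R) := by gcongr
      have h7 : κ * eucNorm D ≤ 2 * (κ / 16) * eucNorm D + (2 * R ^ 3 + S * R) * δ := by
        nlinarith
      have h8 : 2 * R ^ 3 ≤ S := by linarith [pow_nonneg hR 3]
      have h9 : R ≤ S := by linarith [pow_nonneg hR 3, pow_nonneg hR 2]
      have h10 : (2 * R ^ 3 + S * R) * δ ≤ (S + S * (S - 1)) * δ := by
        gcongr
        linarith [pow_nonneg hR 3, pow_nonneg hR 2]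
      rw [hC₁, div_mul_eq_mul_div, div_mul_eq_mul_div, le_div_iff₀ hκ]
      nlinarith
    -- Every remaining term is of second order: `E` and `H - Hh` are `O(δ)` and act on `O(δ)`
    -- vectors, while `c` is `O(δ²)`.
    have hfin : (H * W * Hᵀ) *ᵥ (D - D₀) =
        E *ᵥ D + (-(H - Hh)) *ᵥ (W *ᵥ e) + c • (D + a) := by
      rw [Matrix.mulVec_sub, hGD, hD₀, Matrix.neg_mulVec,
        Matrix.sub_mulVec H Hh]
      abel
    have h1 := mul_eucNorm_le_of_coercive hG (D - D₀)
    rw [hfin] at h1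
    have h2 : eucNorm ((-(H - Hh)) *ᵥ (W *ᵥ e)) ≤ R * δ * (R * (R * δ)) := by
      refine (eucNorm_mulVec_le _ _).trans ?_
      rw [norm_neg]
      gcongr
    have h3 := (eucNorm_add_le (E *ᵥ D + (-(H - Hh)) *ᵥ (W *ᵥ e)) (c • (D + a)))
    have h4 := (eucNorm_add_le (E *ᵥ D) ((-(H - Hh)) *ᵥ (W *ᵥ e)))
    have h5 : S * δ * eucNorm D ≤ S * (C₁ * S) * δ ^ 2 :=
      calc S * δ * eucNorm D ≤ S * δ * (C₁ * (S * δ)) := by gcongr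
        _ = _ := by ring
    have h6 : R * δ * (R * (R * δ)) ≤ S * δ ^ 2 :=
      calc R * δ * (R * (R * δ)) = R ^ 3 * δ ^ 2 := by ring
        _ ≤ _ := by gcongr; linarith [pow_nonneg hR 3]
    have h7 : S * δ ^ 2 * (eucNorm D + R) ≤ S * δ ^ 2 * (C₁ * S + S) := by
      gcongr
      · refine hDb.trans ?_
        rw [← mul_assoc]
        exact mul_le_of_le_one_right (by positivity) hδ1
      · linarith [pow_nonneg hR 3, pow_nonneg hR 2]
    rw [mul_assoc, inv_mul_eq_div, le_div_iff₀' hκ]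
    linarith

end OperatorNorm

/-! ### Multiplication by a stable polynomial -/

section CoeffNorm
open Polynomial

/-- The sum of the squared moduli of the coefficients. -/
noncomputable def coeffNormSq (p : ℂ[X]) : ℝ := ∑ k ∈ p.support, ‖p.coeff k‖ ^ 2

lemma coeffNormSq_nonneg (p : ℂ[X]) : 0 ≤ coeffNormSq p :=
  Finset.sum_nonneg fun _ _ => sq_nonneg _

lemma coeffNormSq_eq_sum_range (p : ℂ[X]) {M : ℕ} (hM : p.natDegree < M) :
    coeffNormSq p = ∑ k ∈ Finset.range M, ‖p.coeff k‖ ^ 2 := by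
  refine Finset.sum_subset (fun k hk => ?_) fun k _ hk => ?_
  · exact Finset.mem_range.2 ((le_natDegree_of_mem_supp k hk).trans_lt hM)
  · simp [notMem_support_iff.1 hk]

/-- On coefficient sequences with the `ℓ²` norm, multiplication by `X` is an isometry and
multiplication by `z` scales by `‖z‖ < 1`. The bounds do not depend on the degree of `p`. -/
lemma coeffNormSq_X_sub_C_mul (p : ℂ[X]) {z : ℂ} (hz : ‖z‖ < 1) :
    (1 - ‖z‖) ^ 2 * coeffNormSq p ≤ coeffNormSq ((X - C z) * p) ∧
      coeffNormSq ((X - C z) * p) ≤ 4 * coeffNormSq p := by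
  set M := p.natDegree + 1 with hM
  set r := ‖z‖
  have hr : 0 ≤ r := norm_nonneg z
  have hdeg : ((X - C z) * p).natDegree < M + 1 := by
    refine natDegree_mul_le.trans_lt ?_
    rw [natDegree_X_sub_C]; omega
  have hN : coeffNormSq p = ∑ k ∈ Finset.range M, ‖p.coeff k‖ ^ 2 :=
    coeffNormSq_eq_sum_range p (by omega)
  have hN' : coeffNormSq p = ‖p.coeff 0‖ ^ 2 + ∑ k ∈ Finset.range M, ‖p.coeff (k + 1)‖ ^ 2 := by
    rw [coeffNormSq_eq_sum_range p (show p.natDegree < M + 1 by omega), Finset.sum_range_succ',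
      add_comm]
  have hexp : coeffNormSq ((X - C z) * p) = r ^ 2 * ‖p.coeff 0‖ ^ 2 +
      ∑ k ∈ Finset.range M, ‖p.coeff k - p.coeff (k + 1) * z‖ ^ 2 := by
    rw [coeffNormSq_eq_sum_range _ hdeg, Finset.sum_range_succ', add_comm, mul_comm (X - C z) p]
    congr 1
    · simp [mul_coeff_zero, mul_pow, r, mul_comm]
    · exact Finset.sum_congr rfl fun k _ => by rw [coeff_mul_X_sub_C]
  -- Termwise, from `2 r ‖u‖ ‖v‖ ≤ r (‖u‖² + ‖v‖²)`; the two weights add up to `(1 - r)²` and `(1 +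
  -- r)²` respectively.
  have hterm : ∀ u v : ℂ, (1 - r) * ‖u‖ ^ 2 + (r ^ 2 - r) * ‖v‖ ^ 2 ≤ ‖u - v * z‖ ^ 2 ∧
      ‖u - v * z‖ ^ 2 ≤ (1 + r) * ‖u‖ ^ 2 + (r ^ 2 + r) * ‖v‖ ^ 2 := by
    intro u v
    have h1 := abs_norm_sub_norm_le u (v * z)
    have h2 := norm_sub_le u (v * z)
    rw [norm_mul] at h1 h2
    have h3 := sq_le_sq.2 (h1.trans (le_abs_self _))
    have h4 := pow_le_pow_left₀ (norm_nonneg _) h2 2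
    have h5 := mul_nonneg hr (sq_nonneg (‖u‖ - ‖v‖))
    change (‖u‖ - ‖v‖ * r) ^ 2 ≤ _ at h3
    change _ ≤ (‖u‖ + ‖v‖ * r) ^ 2 at h4
    constructor <;> nlinarith
  have hlow := Finset.sum_le_sum fun k (_ : k ∈ Finset.range M) =>
    (hterm (p.coeff k) (p.coeff (k + 1))).1
  have hup := Finset.sum_le_sum fun k (_ : k ∈ Finset.range M) =>
    (hterm (p.coeff k) (p.coeff (k + 1))).2
  rw [Finset.sum_add_distrib, ← Finset.mul_sum, ← Finset.mul_sum, ← hN] at hlow hup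
  have hs : ∑ k ∈ Finset.range M, ‖p.coeff (k + 1)‖ ^ 2 =
    coeffNormSq p - ‖p.coeff 0‖ ^ 2 := by rw [hN']; ring
  rw [hs] at hlow hup
  have h0 := sq_nonneg ‖p.coeff 0‖
  have h1 := coeffNormSq_nonneg p
  have h2 := mul_nonneg hr h0
  rw [hexp]
  refine ⟨by nlinarith, ?_⟩
  have h3 : (1 + r) ^ 2 ≤ 4 := by nlinarith
  have h4 := mul_le_mul_of_nonneg_right h3 h1
  nlinarith

/-- Multiplication by a monic polynomial with all roots in the open unit disc is bounded and
bounded below. -/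
lemma exists_bounds_coeffNormSq_mul {q : ℂ[X]} (hq : q.Monic) (hroots : ∀ z ∈ q.roots, ‖z‖ < 1) :
    ∃ c K : ℝ, 0 < c ∧ ∀ p : ℂ[X], c * coeffNormSq p ≤ coeffNormSq (q * p) ∧
      coeffNormSq (q * p) ≤ K * coeffNormSq p := by
  rw [(IsAlgClosed.splits q).eq_prod_roots_of_monic hq]
  generalize q.roots = s at hroots
  induction s using Multiset.induction with
  | empty => exact ⟨1, 1, one_pos, fun p => by simp⟩
  | cons z s ih =>
    obtain ⟨c, K, hc, h⟩ := ih fun w hw => hroots w (Multiset.mem_cons_of_mem hw)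
    have hz := hroots z (Multiset.mem_cons_self z s)
    have hz' : 0 < 1 - ‖z‖ := by linarith
    refine ⟨(1 - ‖z‖) ^ 2 * c, 4 * K, by positivity, fun p => ?_⟩
    rw [Multiset.map_cons, Multiset.prod_cons, mul_assoc (X - C z)]
    obtain ⟨h1, h2⟩ := coeffNormSq_X_sub_C_mul ((s.map fun a => X - C a).prod * p) hz
    obtain ⟨h3, h4⟩ := h p
    constructor
    · refine le_trans ?_ h1
      rw [mul_assoc]
      gcongr
    · refine h2.trans ?_
      rw [mul_assoc]
      gcongr

end CoeffNorm

section Toeplitz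
open Polynomial

variable {nx : ℕ} (A : Matrix (Fin nx) (Fin nx) ℝ)

lemma toeplitz_charCoeffs_apply (n : ℕ) (k : Fin n) (j : Fin (n - nx)) :
    toeplitz (charCoeffs A) n k j =
      if (j : ℕ) ≤ k then A.charpoly.coeff ((k : ℕ) - j) else 0 := by
  have hdeg : A.charpoly.natDegree = nx := by simp
  simp only [toeplitz, Matrix.of_apply, charCoeffs]
  by_cases h1 : (j : ℕ) ≤ k
  · rw [if_pos h1]
    by_cases h2 : (k : ℕ) - j < nx
    · rw [dif_pos ⟨h1, h2⟩]
    · rw [dif_neg (fun h => h2 h.2)]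
      split_ifs with h3
      · have : (k : ℕ) - j = A.charpoly.natDegree := by rw [hdeg]; omega
        rw [this]
        exact A.charpoly_monic.symm
      · exact (coeff_eq_zero_of_natDegree_lt (by rw [hdeg]; omega)).symm
  · rw [if_neg h1, dif_neg (fun h => h1 h.1), if_neg (by omega)]

/-- This identifies `T(a)` with polynomial multiplication, the source of bounds independent of `n`.
-/
lemma toeplitz_mulVec_apply (n : ℕ) (v : Fin (n - nx) → ℝ) (k : Fin n) :
    (toeplitz (charCoeffs A) n *ᵥ v) k =
      (A.charpoly * ∑ j : Fin (n - nx), C (v j) * X ^ (j : ℕ)).coeff k := by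
  rw [Finset.mul_sum, finsetSum_coeff, Matrix.mulVec, dotProduct]
  refine Finset.sum_congr rfl fun j _ => ?_
  rw [toeplitz_charCoeffs_apply, mul_left_comm, coeff_C_mul, coeff_mul_X_pow']
  split_ifs <;> ring

lemma coeffNormSq_map_ofReal {p : ℝ[X]} {n : ℕ} (hp : p.natDegree < n) :
    coeffNormSq (p.map (algebraMap ℝ ℂ)) = ∑ k : Fin n, p.coeff k ^ 2 := by
  rw [coeffNormSq_eq_sum_range _ (natDegree_map_le.trans_lt hp), Finset.sum_range]
  simp

/-- The Toeplitz matrices of a stable characteristic polynomial are bounded and bounded below,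
uniformly in their size. -/
lemma exists_bounds_toeplitz (hA : IsSchurStable A) :
    ∃ c K : ℝ, 0 < c ∧ 0 ≤ K ∧ ∀ n (v : Fin (n - nx) → ℝ),
      c * (v ⬝ᵥ v) ≤ (toeplitz (charCoeffs A) n *ᵥ v) ⬝ᵥ (toeplitz (charCoeffs A) n *ᵥ v) ∧
      (toeplitz (charCoeffs A) n *ᵥ v) ⬝ᵥ (toeplitz (charCoeffs A) n *ᵥ v) ≤ K * (v ⬝ᵥ v) := by
  have hmap : A.charpoly.map (algebraMap ℝ ℂ) = (A.map (algebraMap ℝ ℂ)).charpoly :=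
    (Matrix.charpoly_map A (algebraMap ℝ ℂ)).symm
  have hroots : ∀ z ∈ (A.charpoly.map (algebraMap ℝ ℂ)).roots, ‖z‖ < 1 := by
    intro z hz
    rw [hmap] at hz
    have hmem : z ∈ spectrum ℂ (A.map (algebraMap ℝ ℂ)) :=
      Matrix.mem_spectrum_iff_isRoot_charpoly.2 (isRoot_of_mem_roots hz)
    have h1 : (‖z‖₊ : ENNReal) ≤ spectralRadius ℂ (A.map (algebraMap ℝ ℂ)) :=
      le_iSup₂ (α := ENNReal) (f := fun k (_ : k ∈ spectrum ℂ _) => (‖k‖₊ : ENNReal)) z hmem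
    have h2 := h1.trans_lt hA
    exact_mod_cast h2
  obtain ⟨c, K, hc, h⟩ := exists_bounds_coeffNormSq_mul (A.charpoly_monic.map _) hroots
  refine ⟨c, max K 0, hc, le_max_right _ _, fun n v => ?_⟩
  -- For `n ≤ nx` the matrix has no columns, and the strict degree bounds used below would fail.
  rcases Nat.eq_zero_or_pos (n - nx) with h0 | h0
  · have hv : v = 0 := by
      ext j; exact absurd j.2 (by omega)
    simp [hv]
  set p : ℝ[X] := ∑ j : Fin (n - nx), C (v j) * X ^ (j : ℕ) with hp
  have hpdeg : p.natDegree < n - nx := by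
    refine (natDegree_sum_le_of_forall_le (n := n - nx - 1) _ _ fun j _ => ?_).trans_lt (by omega)
    exact (natDegree_C_mul_X_pow_le _ _).trans (by omega)
  have hqp : (A.charpoly * p).natDegree < n := by
    refine natDegree_mul_le.trans_lt ?_
    have : A.charpoly.natDegree = nx := by simp
    omega
  have hcoeff : ∀ j : Fin (n - nx), p.coeff j = v j := by
    intro j
    rw [hp, finsetSum_coeff]
    simp [coeff_X_pow, Fin.val_inj]
  have h1 : coeffNormSq (p.map (algebraMap ℝ ℂ)) = v ⬝ᵥ v := by
    rw [coeffNormSq_map_ofReal hpdeg, dotProduct]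
    simp [hcoeff, sq]
  have h2 : coeffNormSq ((A.charpoly * p).map (algebraMap ℝ ℂ)) =
      (toeplitz (charCoeffs A) n *ᵥ v) ⬝ᵥ (toeplitz (charCoeffs A) n *ᵥ v) := by
    rw [coeffNormSq_map_ofReal hqp, dotProduct]
    exact Finset.sum_congr rfl fun k _ => by rw [toeplitz_mulVec_apply, ← hp, sq]
  have h3 := h (p.map (algebraMap ℝ ℂ))
  rw [← Polynomial.map_mul, h1, h2] at h3
  exact ⟨h3.1, h3.2.trans (mul_le_mul_of_nonneg_right (le_max_left _ _)
    (dotProduct_self_nonneg' v))⟩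

end Toeplitz

/-! ### The residual of the Hankel regression -/

/-- `[a 1] H(g) = gᵀ T(a)`. -/
lemma hankel_residual_eq {nx n : ℕ} (a : Fin nx → ℝ) (g : Fin n → ℝ) :
    -hankelBot nx g - (hankelTop nx g)ᵀ *ᵥ a = -((toeplitz a n)ᵀ *ᵥ g) := by
  ext j
  have hj := j.2
  -- Only the `nx + 1` entries in the band of column `j` are nonzero.
  have hsum : ((toeplitz a n)ᵀ *ᵥ g) j =
      ∑ i : Fin (nx + 1), toeplitz a n ⟨i + j, by omega⟩ j * g ⟨i + j, by omega⟩ := by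
    rw [Matrix.mulVec, dotProduct]
    refine (Fintype.sum_of_injective (fun i : Fin (nx + 1) => (⟨i + j, by omega⟩ : Fin n))
      (fun i i' h => ?_) _ _ (fun k hk => ?_) fun i => ?_).symm
    · simp only [Fin.mk.injEq] at h
      exact Fin.ext (by omega)
    · have : toeplitz a n k j = 0 := by
        have hne : ¬((j : ℕ) ≤ k ∧ (k : ℕ) ≤ j + nx) := by
          rintro ⟨h1, h2⟩
          exact hk ⟨⟨k - j, by omega⟩, Fin.ext (by simp; omega)⟩
        rw [toeplitz, Matrix.of_apply, dif_neg (by omega), if_neg (by omega)]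
      simp [this]
    · simp
  rw [Pi.neg_apply, hsum, Fin.sum_univ_castSucc]
  have h1 : ∀ i : Fin nx, toeplitz a n ⟨(i.castSucc : ℕ) + j, by simp; omega⟩ j = a i := by
    intro i
    have hi := i.2
    rw [toeplitz, Matrix.of_apply, dif_pos (by simp)]
    simp
  have h2 : toeplitz a n ⟨(Fin.last nx : ℕ) + j, by simp; omega⟩ j = 1 := by
    rw [toeplitz, Matrix.of_apply, dif_neg (by simp), if_pos (by simp; omega)]
  simp only [h1, h2]
  simp only [Pi.sub_apply, Pi.neg_apply, hankelBot, hankel, hankelTop, Matrix.mulVec, dotProduct,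
    Matrix.transpose_apply, Matrix.of_apply, one_mul]
  rw [neg_add, sub_eq_add_neg, add_comm]
  congr 2
  exact Finset.sum_congr rfl fun i _ => mul_comm _ _

lemma hankelTop_add {nx n : ℕ} (g g' : Fin n → ℝ) :
    hankelTop nx (g + g') = hankelTop nx g + hankelTop nx g' := by
  ext i j; simp [hankelTop, hankel]

/-- The Cayley–Hamilton recursion: the Markov parameters are annihilated by `T(a)ᵀ`. -/
lemma toeplitz_transpose_mulVec_markovVec {nx : ℕ} (A : Matrix (Fin nx) (Fin nx) ℝ)
    (B C : Fin nx → ℝ) (n : ℕ) :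
    (toeplitz (charCoeffs A) n)ᵀ *ᵥ markovVec A B C n = 0 := by
  rw [← neg_eq_zero, ← hankel_residual_eq]
  ext j
  have hCH : ∑ i : Fin nx, charCoeffs A i • A ^ (i : ℕ) + A ^ nx = 0 := by
    have h := Matrix.aeval_self_charpoly A
    rw [Polynomial.aeval_eq_sum_range] at h
    have hdeg : A.charpoly.natDegree = nx := by simp
    rw [hdeg, Finset.sum_range_succ, Finset.sum_range] at h
    have hlead : A.charpoly.coeff nx = 1 := by
      have := A.charpoly_monic.coeff_natDegree
      rwa [hdeg] at this
    rwa [hlead, one_smul] at h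
  have h := congrArg (fun M : Matrix (Fin nx) (Fin nx) ℝ => C ⬝ᵥ ((M * A ^ (j : ℕ)) *ᵥ B)) hCH
  simp only [add_mul, Finset.sum_mul, Matrix.add_mulVec, dotProduct_add, Matrix.sum_mulVec,
    dotProduct_sum, smul_mul_assoc, Matrix.smul_mulVec, dotProduct_smul, ← pow_add,
    zero_mul, Matrix.zero_mulVec, dotProduct_zero, smul_eq_mul] at h
  simp only [Pi.sub_apply, Pi.neg_apply, hankelBot, hankel, hankelTop, Matrix.mulVec, dotProduct,
    Matrix.transpose_apply, Matrix.of_apply, markovVec, Pi.zero_apply]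
  have h2 : ∑ i : Fin nx, markov A B C (i.castSucc + j) * charCoeffs A i =
      ∑ i : Fin nx, charCoeffs A i * C ⬝ᵥ (A ^ ((i : ℕ) + j)) *ᵥ B :=
    Finset.sum_congr rfl fun i _ => by rw [mul_comm]; rfl
  have h3 : markov A B C (Fin.last nx + j) = C ⬝ᵥ (A ^ (nx + (j : ℕ))) *ᵥ B := rfl
  rw [h2, h3]
  linarith

/-! ### Uniform bounds for the Hankel matrices -/

section Hankel
open scoped Matrix.Norms.L2Operator

lemma isUnit_of_rank_eq {k : ℕ} {M : Matrix (Fin k) (Fin k) ℝ} (h : M.rank = k) : IsUnit M := by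
  rw [← Matrix.mulVec_surjective_iff_isUnit]
  have : LinearMap.range M.mulVecLin = ⊤ :=
    Submodule.eq_top_of_finrank_eq (by rw [Module.finrank_fin_fun]; exact h)
  exact LinearMap.range_eq_top.1 this

/-- Gelfand's formula gives `‖M ^ k‖ < r ^ k` eventually, for some `r < 1`. -/
lemma summable_norm_pow_of_spectralRadius_lt_one {𝓐 : Type*} [NormedRing 𝓐] [NormedAlgebra ℂ 𝓐]
    [CompleteSpace 𝓐] {M : 𝓐} (h : spectralRadius ℂ M < 1) : Summable fun k : ℕ => ‖M ^ k‖ := by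
  obtain ⟨r, hr, hr1⟩ := ENNReal.lt_iff_exists_nnreal_btwn.1 h
  have hr1' : r < 1 := by exact_mod_cast hr1
  have hev := (spectrum.pow_nnnorm_pow_one_div_tendsto_nhds_spectralRadius M).eventually_lt_const hr
  refine Summable.of_norm_bounded_eventually_nat (g := fun k => (r : ℝ) ^ k)
    (summable_geometric_of_lt_one r.2 hr1') ?_
  filter_upwards [hev, eventually_gt_atTop 0] with k hk hk0
  rw [norm_norm]
  have hk' : ((k : ℕ) : ℝ) ≠ 0 := by exact_mod_cast hk0.ne'
  have h2 := ENNReal.rpow_le_rpow hk.le (z := (k : ℝ)) (by positivity)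
  rw [← ENNReal.rpow_mul, one_div, inv_mul_cancel₀ hk', ENNReal.rpow_one,
    ENNReal.rpow_natCast] at h2
  exact_mod_cast h2

variable {nx : ℕ} {A : Matrix (Fin nx) (Fin nx) ℝ}

/-- The Markov parameters are the values of one linear functional at the powers of `A`, complexified
because the spectral radius is. -/
lemma summable_abs_markov (hA : IsSchurStable A) (B C : Fin nx → ℝ) :
    Summable fun k => |markov A B C k| := by
  let f : Matrix (Fin nx) (Fin nx) ℂ →ₗ[ℂ] ℂ :=
    { toFun := fun M => (fun i => (C i : ℂ)) ⬝ᵥ (M *ᵥ fun i => (B i : ℂ))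
      map_add' := fun M M' => by rw [Matrix.add_mulVec, dotProduct_add]
      map_smul' := fun c M => by rw [Matrix.smul_mulVec, dotProduct_smul]; rfl }
  have hf : ∀ k, f (A.map (algebraMap ℝ ℂ) ^ k) = (markov A B C k : ℂ) := by
    intro k
    have h1 : A.map (algebraMap ℝ ℂ) ^ k = (A ^ k).map (algebraMap ℝ ℂ) :=
      (Matrix.map_pow A (algebraMap ℝ ℂ) k).symm
    rw [h1]
    simp [f, markov, dotProduct, Matrix.mulVec]
  have hs := (summable_norm_pow_of_spectralRadius_lt_one hA).mul_left ‖f.toContinuousLinearMap‖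
  refine Summable.of_nonneg_of_le (fun k => abs_nonneg _) (fun k => ?_) hs
  have h2 := f.toContinuousLinearMap.le_opNorm (A.map (algebraMap ℝ ℂ) ^ k)
  have h3 : f.toContinuousLinearMap (A.map (algebraMap ℝ ℂ) ^ k) = (markov A B C k : ℂ) := hf k
  rw [h3, Complex.norm_real] at h2
  exact h2

lemma exists_eucNorm_markovVec_le (hA : IsSchurStable A) (B C : Fin nx → ℝ) :
    ∃ S : ℝ, 0 ≤ S ∧ ∀ n, eucNorm (markovVec A B C n) ≤ S := by
  have hs := summable_abs_markov hA B C
  refine ⟨∑' k, |markov A B C k|, tsum_nonneg fun k => abs_nonneg _, fun n => ?_⟩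
  refine le_of_sq_le_sq ?_ (tsum_nonneg fun k => abs_nonneg _)
  rw [eucNorm_sq, dotProduct]
  calc ∑ k : Fin n, markovVec A B C n k * markovVec A B C n k
      ≤ ∑ k : Fin n, (∑' j, |markov A B C j|) * |markov A B C k| := by
        refine Finset.sum_le_sum fun k _ => ?_
        rw [markovVec, ← abs_mul_abs_self]
        gcongr
        exact hs.le_tsum (k : ℕ) fun j _ => abs_nonneg _
    _ = (∑' j, |markov A B C j|) * ∑ k ∈ Finset.range n, |markov A B C k| := by
        rw [← Finset.mul_sum, Finset.sum_range]
    _ ≤ (∑' j, |markov A B C j|) ^ 2 := by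
        rw [sq]
        exact mul_le_mul_of_nonneg_left (hs.sum_le_tsum _ fun j _ => abs_nonneg _)
          (tsum_nonneg fun k => abs_nonneg _)

/-- Each of the `nx` rows is a window of `g`, so the factor does not involve `n`. Applied to the
estimation error, it bounds the perturbation of the Hankel matrix. -/
lemma opNorm_hankelTop_le (nx : ℕ) {n : ℕ} (g : Fin n → ℝ) :
    ‖hankelTop nx g‖ ≤ √nx * eucNorm g := by
  refine l2_opNorm_le_of_eucNorm_le (by positivity) fun v => ?_
  refine le_of_sq_le_sq ?_ (by positivity)
  rw [mul_pow, mul_pow, Real.sq_sqrt (by positivity), eucNorm_sq, dotProduct]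
  calc ∑ i, (hankelTop nx g *ᵥ v) i * (hankelTop nx g *ᵥ v) i
      ≤ ∑ i : Fin nx, eucNorm g ^ 2 * eucNorm v ^ 2 := by
        refine Finset.sum_le_sum fun i _ => ?_
        have h1 := abs_dotProduct_le (hankelTop nx g i) v
        have h2 := pow_le_pow_left₀ (abs_nonneg _) h1 2
        rw [sq_abs, mul_pow] at h2
        rw [← sq]
        refine h2.trans ?_
        gcongr ?_ * _
        rw [eucNorm_sq, eucNorm_sq, dotProduct, dotProduct]
        let φ : Fin (n - nx) → Fin n := fun j => ⟨i + j, by omega⟩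
        have hφ : Function.Injective φ := fun j j' h => by
          simp only [φ, Fin.mk.injEq] at h
          exact Fin.ext (by omega)
        calc ∑ j, hankelTop nx g i j * hankelTop nx g i j = ∑ j, g (φ j) * g (φ j) := rfl
          _ = ∑ k ∈ Finset.univ.map ⟨φ, hφ⟩, g k * g k := by rw [Finset.sum_map]; rfl
          _ ≤ ∑ k, g k * g k := Finset.sum_le_sum_of_subset_of_nonneg (Finset.subset_univ _)
              fun k _ _ => mul_self_nonneg _
    _ = nx * eucNorm g ^ 2 * eucNorm v ^ 2 := by simp; ring

/-- The Hankel matrices of a minimal system have full row rank, uniformly in the number of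
columns. -/
lemma exists_hankelTop_coercive {B C : Fin nx → ℝ} (hctrl : IsControllable A B)
    (hobs : IsObservable A C) :
    ∃ κ : ℝ, 0 < κ ∧ ∀ n, 2 * nx ≤ n → ∀ v : Fin nx → ℝ,
      κ * (v ⬝ᵥ v) ≤ ((hankelTop nx (markovVec A B C n))ᵀ *ᵥ v) ⬝ᵥ
        ((hankelTop nx (markovVec A B C n))ᵀ *ᵥ v) := by
  set O := Matrix.of fun (i j : Fin nx) => (C ᵥ* (A ^ (i : ℕ))) j
  set R := Matrix.of fun (i j : Fin nx) => ((A ^ (j : ℕ)) *ᵥ B) i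
  have hunit : IsUnit (O * R)ᵀ := by
    have h1 : IsUnit O := isUnit_of_rank_eq hobs
    have h2 : IsUnit R := isUnit_of_rank_eq hctrl
    rw [Matrix.isUnit_transpose]
    exact h1.mul h2
  -- The leading square block of `H⁺` is observability times controllability matrix, hence
  -- invertible and independent of `n`; the remaining columns only add squares.
  have hentry : ∀ i j : Fin nx, (O * R) i j = markov A B C (i + j) := by
    intro i j
    rw [Matrix.mul_apply', markov, pow_add, ← Matrix.mulVec_mulVec, Matrix.dotProduct_mulVec]
    rfl
  set t := ‖((O * R)ᵀ)⁻¹‖ + 1 with ht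
  have ht0 : 0 < t := by positivity
  refine ⟨(t ^ 2)⁻¹, by positivity, fun n hn v => ?_⟩
  have h1 : eucNorm v ≤ t * eucNorm ((O * R)ᵀ *ᵥ v) := by
    have h := eucNorm_mulVec_le ((O * R)ᵀ)⁻¹ ((O * R)ᵀ *ᵥ v)
    rw [Matrix.mulVec_mulVec, Matrix.nonsing_inv_mul _ ((Matrix.isUnit_iff_isUnit_det _).1 hunit),
      Matrix.one_mulVec] at h
    refine h.trans ?_
    gcongr
    linarith
  have h2 := pow_le_pow_left₀ (norm_nonneg _) h1 2
  rw [mul_pow, eucNorm_sq, eucNorm_sq, ← inv_mul_le_iff₀ (by positivity)] at h2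
  refine h2.trans ?_
  simp only [dotProduct]
  let φ : Fin nx → Fin (n - nx) := fun j => ⟨j, by omega⟩
  have hφ : Function.Injective φ := fun j j' h => by
    simp only [φ, Fin.mk.injEq] at h
    exact Fin.ext h
  set u := (hankelTop nx (markovVec A B C n))ᵀ *ᵥ v
  calc ∑ j, ((O * R)ᵀ *ᵥ v) j * ((O * R)ᵀ *ᵥ v) j = ∑ j, u (φ j) * u (φ j) := by
        have : ∀ j, ((O * R)ᵀ *ᵥ v) j = u (φ j) := by
          intro j
          simp only [u, Matrix.mulVec, dotProduct, Matrix.transpose_apply, hentry]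
          rfl
        simp only [this]
    _ = ∑ k ∈ Finset.univ.map ⟨φ, hφ⟩, u k * u k := by rw [Finset.sum_map]; rfl
    _ ≤ ∑ k, u k * u k := Finset.sum_le_sum_of_subset_of_nonneg (Finset.subset_univ _)
        fun k _ _ => mul_self_nonneg _

end Hankel

/-! ### The delta method in growing dimension -/

lemma eucNorm_mulVec_sq_le_of_sum_sq_le {m l : ℕ} {M : Matrix (Fin m) (Fin l) ℝ} {K : ℝ}
    (hM : ∑ i, ∑ j, M i j ^ 2 ≤ K) (v : Fin l → ℝ) :
    eucNorm (M *ᵥ v) ^ 2 ≤ K * eucNorm v ^ 2 := by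
  refine le_trans ?_ (mul_le_mul_of_nonneg_right hM (sq_nonneg _))
  rw [eucNorm_sq, eucNorm_sq, dotProduct, Finset.sum_mul]
  refine Finset.sum_le_sum fun i _ => ?_
  have h := Finset.sum_mul_sq_le_sq_mul_sq Finset.univ (M i) v
  rw [← sq]
  simpa only [dotProduct, ← sq, Matrix.mulVec] using h

lemma sum_sq_transpose_mul_le {m l k : ℕ} {L : Matrix (Fin l) (Fin m) ℝ}
    {M : Matrix (Fin l) (Fin k) ℝ} {R K : ℝ} (hL : ∑ i, ∑ j, L i j ^ 2 ≤ R)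
    (hM : ∑ i, ∑ j, M i j ^ 2 ≤ K) : ∑ i, ∑ j, (Lᵀ * M) i j ^ 2 ≤ R * K := by
  have h0 : 0 ≤ ∑ i, ∑ j, M i j ^ 2 :=
    Finset.sum_nonneg fun _ _ => Finset.sum_nonneg fun _ _ => sq_nonneg _
  have h1 : 0 ≤ ∑ i, ∑ j, L i j ^ 2 :=
    Finset.sum_nonneg fun _ _ => Finset.sum_nonneg fun _ _ => sq_nonneg _
  calc ∑ i, ∑ j, (Lᵀ * M) i j ^ 2
      ≤ ∑ i, ∑ j, (∑ t, L t i ^ 2) * ∑ t, M t j ^ 2 :=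
        Finset.sum_le_sum fun i _ => Finset.sum_le_sum fun j _ =>
          Finset.sum_mul_sq_le_sq_mul_sq Finset.univ (fun t => L t i) (fun t => M t j)
    _ = (∑ i, ∑ t, L t i ^ 2) * ∑ j, ∑ t, M t j ^ 2 := by rw [Finset.sum_mul_sum]
    _ = (∑ i, ∑ j, L i j ^ 2) * ∑ i, ∑ j, M i j ^ 2 := by
        rw [Finset.sum_comm, Finset.sum_comm (f := fun j t => M t j ^ 2)]
    _ ≤ R * K := mul_le_mul hL hM h0 (h1.trans hL)

/-- The delta method in growing dimension: an estimate that is linear in the error of an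
asymptotically normal vector, up to a quadratic remainder, is asymptotically normal. -/
lemma AsymptoticallyNormal.of_linearization {Ω : Type*} [MeasurableSpace Ω] {μ : Measure Ω}
    [IsProbabilityMeasure μ] {n : ℕ → ℕ} (hn_top : Tendsto n atTop atTop)
    (hrate : Tendsto (fun N : ℕ => (n N : ℝ) / √(N : ℝ)) atTop (𝓝 0))
    {g : (N : ℕ) → Fin (n N) → ℝ} {ghat : (N : ℕ) → Ω → Fin (n N) → ℝ}
    (hmeas : ∀ N, AEMeasurable (ghat N) μ) {P : (N : ℕ) → Matrix (Fin (n N)) (Fin (n N)) ℝ}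
    (hnormal : AsymptoticallyNormal μ n (fun N ω => √(N : ℝ) • (ghat N ω - g N)) P)
    {l : ℕ} {est : (N : ℕ) → (Fin (n N) → ℝ) → Fin l → ℝ} (hest : ∀ N, Measurable (est N))
    {a : Fin l → ℝ} {L : (N : ℕ) → Matrix (Fin l) (Fin (n N)) ℝ}
    {V : ℕ → Matrix (Fin l) (Fin l) ℝ} {C δ₀ R : ℝ} (hC : 0 ≤ C) (hδ₀ : 0 < δ₀)
    (hlin : ∀ᶠ N in atTop, ∀ x, eucNorm x ≤ δ₀ →
      eucNorm (est N (g N + x) - a - L N *ᵥ x) ≤ C * eucNorm x ^ 2)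
    (hL : ∀ᶠ N in atTop, ∑ i, ∑ j, L N i j ^ 2 ≤ R)
    (hV : ∀ᶠ N in atTop, V N = L N * P N * (L N)ᵀ)
    (hbd : ∃ c K : ℝ, 0 < c ∧
      ∀ᶠ N in atTop, (V N - c • 1).PosSemidef ∧ (K • 1 - V N).PosSemidef) :
    AsymptoticallyNormal μ (fun _ => l)
      (fun N ω => √(N : ℝ) • (est N (ghat N ω) - a)) V := by
  classical
  refine ⟨hbd, fun m Υ Q ⟨K, hK⟩ hQ => ?_⟩
  have hK0 : 0 ≤ K := le_trans
    (Finset.sum_nonneg fun _ _ => Finset.sum_nonneg fun _ _ => sq_nonneg _) (hK 0)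
  -- A direction `Υ` for the estimate is pulled back to `Lᵀ Υ` for the data, with the same limiting
  -- variance. The default 0 keeps the sequence bounded for all `N`.
  let Υ' : (N : ℕ) → Matrix (Fin (n N)) (Fin m) ℝ := fun N =>
    if ∑ i, ∑ j, L N i j ^ 2 ≤ R then (L N)ᵀ * Υ N else 0
  have hΥ' : ∀ᶠ N in atTop, Υ' N = (L N)ᵀ * Υ N := by
    filter_upwards [hL] with N hN using if_pos hN
  have hdist := hnormal.2 m Υ' Q ⟨max (R * K) 0, fun N => ?_⟩ ?_
  rotate_left
  · by_cases hN : ∑ i, ∑ j, L N i j ^ 2 ≤ R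
    · simp only [Υ', if_pos hN]
      exact (sum_sq_transpose_mul_le hN (hK N)).trans (le_max_left _ _)
    · simp [Υ', if_neg hN]
  · refine hQ.congr' ?_
    filter_upwards [hΥ', hV] with N h1 h2
    rw [h1, h2]
    simp only [Matrix.transpose_mul, Matrix.transpose_transpose, Matrix.mul_assoc]
  have hXm : ∀ N : ℕ, AEMeasurable (fun ω => √(N : ℝ) • (ghat N ω - g N)) μ := fun N =>
    (show Continuous fun y : Fin (n N) → ℝ => √(N : ℝ) • (y - g N) by fun_prop).measurable
      |>.comp_aemeasurable (hmeas N)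
  -- Slutsky's theorem: it suffices that the scaled remainder tends to 0 in probability.
  refine tendstoInDistribution_of_tendstoInMeasure_sub _ _ hdist ?_ fun N => ?_
  swap
  · have h1 : AEMeasurable (fun ω => est N (ghat N ω)) μ := (hest N).comp_aemeasurable (hmeas N)
    have h2 : Continuous fun x : Fin l → ℝ =>
        (WithLp.toLp 2 ((√(N : ℝ) • (x - a)) ᵥ* Υ N) : EuclideanSpace ℝ (Fin m)) := by
      refine (PiLp.continuous_toLp 2 _).comp ?_
      exact Continuous.matrix_vecMul (by fun_prop) continuous_const
    exact h2.measurable.comp_aemeasurable h1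
  rw [tendstoInMeasure_iff_norm]
  intro ε hε
  rw [ENNReal.tendsto_nhds_zero]
  intro η hη
  obtain ⟨M, hM, htail⟩ := hnormal.exists_tail_bound hXm
    ((hn_top.eventually_gt_atTop 0)) hη
  have hsmall1 : ∀ᶠ N : ℕ in atTop, M * ((n N : ℝ) / √(N : ℝ)) < δ₀ := by
    have := hrate.const_mul M
    rw [mul_zero] at this
    exact this.eventually (gt_mem_nhds hδ₀)
  have hsmall2 : ∀ᶠ N : ℕ in atTop, √K * (C * (M ^ 2 * ((n N : ℝ) / √(N : ℝ)))) < ε := by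
    have := ((hrate.const_mul (M ^ 2)).const_mul C).const_mul √K
    simp only [mul_zero] at this
    exact this.eventually (gt_mem_nhds hε)
  filter_upwards [htail, hsmall1, hsmall2, hΥ', hlin, eventually_gt_atTop 0] with
    N hN h1 h2 h3 h4 hN0
  refine le_trans (measure_mono fun ω hω => ?_) hN
  by_contra hcon
  have hXlt : eucNorm (√(N : ℝ) • (ghat N ω - g N)) < M * √(n N) := not_le.1 hcon
  have hs : 0 < √(N : ℝ) := Real.sqrt_pos.2 (by exact_mod_cast hN0)
  set x := ghat N ω - g N with hx
  rw [eucNorm_smul, abs_of_pos hs] at hXlt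
  have hx1 : eucNorm x < M * √(n N) / √(N : ℝ) := by rwa [lt_div_iff₀' hs]
  have hnn : √(n N : ℝ) ≤ n N := by
    rw [Real.sqrt_le_left (by positivity)]
    exact_mod_cast Nat.le_self_pow (by norm_num) _
  have hxδ : eucNorm x ≤ δ₀ := by
    refine hx1.le.trans (le_trans ?_ h1.le)
    rw [mul_div_assoc]
    gcongr
  have hl := h4 x hxδ
  have hgx : g N + x = ghat N ω := by rw [hx]; abel
  rw [hgx] at hl
  set w := est N (ghat N ω) - a - L N *ᵥ x
  have hval : (√(N : ℝ) • (est N (ghat N ω) - a)) ᵥ* Υ N - (√(N : ℝ) • x) ᵥ* Υ' N =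
      (Υ N)ᵀ *ᵥ (√(N : ℝ) • w) := by
    rw [h3, ← Matrix.vecMul_vecMul, Matrix.vecMul_transpose, ← Matrix.sub_vecMul,
      Matrix.mulVec_transpose, Matrix.mulVec_smul, ← smul_sub]
  have hω' : ε ≤ eucNorm ((√(N : ℝ) • (est N (ghat N ω) - a)) ᵥ* Υ N -
      (√(N : ℝ) • x) ᵥ* Υ' N) := by
    simp only [Set.mem_ofPred_eq, Pi.zero_apply, sub_zero, Pi.sub_apply] at hω
    exact hω
  rw [hval] at hω'
  have hfrob : ∑ i, ∑ j, (Υ N)ᵀ i j ^ 2 ≤ K := by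
    rw [Finset.sum_comm]; exact hK N
  have hb := Real.le_sqrt_of_sq_le (eucNorm_mulVec_sq_le_of_sum_sq_le hfrob (√(N : ℝ) • w))
  rw [Real.sqrt_mul hK0, Real.sqrt_sq (norm_nonneg _)] at hb
  have hwn : ‖WithLp.toLp 2 (√(N : ℝ) • w)‖ = √(N : ℝ) * eucNorm w := by
    rw [← abs_of_pos hs, ← eucNorm_smul, abs_of_pos hs]
  rw [hwn] at hb
  -- Off the tail event `‖x‖² < M² n / N`, so the scaled quadratic remainder is of order `n / √N`.
  have hx2 : √(N : ℝ) * (C * eucNorm x ^ 2) ≤ C * (M ^ 2 * ((n N : ℝ) / √(N : ℝ))) := by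
    have h5 := pow_le_pow_left₀ (norm_nonneg _) hx1.le 2
    rw [div_pow, mul_pow, Real.sq_sqrt (by positivity)] at h5
    calc √(N : ℝ) * (C * eucNorm x ^ 2)
        ≤ √(N : ℝ) * (C * (M ^ 2 * n N / √(N : ℝ) ^ 2)) := by gcongr
      _ = _ := by field_simp
  have : √K * (√(N : ℝ) * eucNorm w) ≤ √K * (C * (M ^ 2 * ((n N : ℝ) / √(N : ℝ)))) :=
    mul_le_mul_of_nonneg_left ((mul_le_mul_of_nonneg_left hl hs.le).trans hx2) (Real.sqrt_nonneg K)
  linarith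

lemma tendsto_div_sqrt_of_rate {n : ℕ → ℕ} {δ : ℝ} (hδ : 0 < δ)
    (h : Tendsto (fun N : ℕ => (n N : ℝ) ^ (4 + δ) / (N : ℝ)) atTop (𝓝 0)) :
    Tendsto (fun N : ℕ => (n N : ℝ) / √(N : ℝ)) atTop (𝓝 0) := by
  have h1 : Tendsto (fun N : ℕ => (n N : ℝ) ^ 2 / (N : ℝ)) atTop (𝓝 0) := by
    refine squeeze_zero (fun N => by positivity) (fun N => ?_) h
    gcongr
    rcases Nat.eq_zero_or_pos (n N) with h0 | h0
    · rw [h0]; simp [Real.zero_rpow (by linarith : (4 + δ) ≠ 0)]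
    · rw [← Real.rpow_natCast]
      exact Real.rpow_le_rpow_of_exponent_le (by exact_mod_cast h0) (by push_cast; linarith)
  have h2 := h1.sqrt
  rw [Real.sqrt_zero] at h2
  refine h2.congr fun N => ?_
  rw [Real.sqrt_div (by positivity), Real.sqrt_sq (by positivity)]

/-! ### Weights and covariances -/

section Inverse
variable {k : ℕ} {V : Matrix (Fin k) (Fin k) ℝ}

lemma transpose_inv_eq_of_transpose_eq (hV : Vᵀ = V) : (V⁻¹)ᵀ = V⁻¹ := by
  rw [Matrix.transpose_nonsing_inv, hV]

lemma mul_inv_of_isUnit (hu : IsUnit V) : V * V⁻¹ = 1 :=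
  Matrix.mul_nonsing_inv _ ((Matrix.isUnit_iff_isUnit_det _).1 hu)

lemma inv_mul_of_isUnit (hu : IsUnit V) : V⁻¹ * V = 1 :=
  Matrix.nonsing_inv_mul _ ((Matrix.isUnit_iff_isUnit_det _).1 hu)

/-- Inversion reverses the Loewner order; it follows from nonnegativity of the form of `V` at `V⁻¹ v
- K⁻¹ v`. -/
lemma le_dotProduct_inv_mulVec (hV : Vᵀ = V) {c K : ℝ} (hc : 0 < c) (hK : 0 < K)
    (hlow : ∀ v, c * (v ⬝ᵥ v) ≤ v ⬝ᵥ (V *ᵥ v)) (hup : ∀ v, v ⬝ᵥ (V *ᵥ v) ≤ K * (v ⬝ᵥ v))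
    (v : Fin k → ℝ) : K⁻¹ * (v ⬝ᵥ v) ≤ v ⬝ᵥ (V⁻¹ *ᵥ v) := by
  set u := V⁻¹ *ᵥ v
  have hu : V *ᵥ u = v := by
    rw [Matrix.mulVec_mulVec, mul_inv_of_isUnit (isUnit_of_coercive hc hlow), Matrix.one_mulVec]
  have h1 := hlow (u - K⁻¹ • v)
  have h2 := hup v
  have h3 : u ⬝ᵥ (V *ᵥ v) = v ⬝ᵥ v := by
    have := dotProduct_transpose_mulVec V u v
    rwa [hV, hu] at this
  have h4 := mul_nonneg hc.le (dotProduct_self_nonneg' (u - K⁻¹ • v))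
  have h5 : (u - K⁻¹ • v) ⬝ᵥ (V *ᵥ (u - K⁻¹ • v)) =
      v ⬝ᵥ u - 2 * K⁻¹ * (v ⬝ᵥ v) + K⁻¹ * (K⁻¹ * (v ⬝ᵥ (V *ᵥ v))) := by
    simp only [Matrix.mulVec_sub, Matrix.mulVec_smul, hu, sub_dotProduct, dotProduct_sub,
      smul_dotProduct, dotProduct_smul, smul_eq_mul, h3, dotProduct_comm u v]
    ring
  have h6 : K⁻¹ * (K⁻¹ * (v ⬝ᵥ (V *ᵥ v))) ≤ K⁻¹ * (v ⬝ᵥ v) := by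
    refine mul_le_mul_of_nonneg_left ?_ (by positivity)
    rw [inv_mul_le_iff₀ hK]
    exact h2
  linarith

section
open scoped Matrix.Norms.L2Operator

lemma dotProduct_inv_mulVec_le {c : ℝ} (hc : 0 < c)
    (hlow : ∀ v, c * (v ⬝ᵥ v) ≤ v ⬝ᵥ (V *ᵥ v)) (v : Fin k → ℝ) :
    v ⬝ᵥ (V⁻¹ *ᵥ v) ≤ c⁻¹ * (v ⬝ᵥ v) :=
  ((le_abs_self _).trans (dotProduct_mulVec_le_opNorm _ _)).trans
    (mul_le_mul_of_nonneg_right (l2_opNorm_inv_le_of_coercive hc hlow) (dotProduct_self_nonneg' v))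

end

end Inverse

section Pinv
variable {r s : ℕ} {M : Matrix (Fin r) (Fin s) ℝ}

lemma isMoorePenrose_of_fullRowRank (h : IsUnit (M * Mᵀ)) :
    IsMoorePenrose M (Mᵀ * (M * Mᵀ)⁻¹) := by
  have h1 : M * (Mᵀ * (M * Mᵀ)⁻¹) = 1 := by rw [← Matrix.mul_assoc, mul_inv_of_isUnit h]
  refine ⟨by rw [h1, Matrix.one_mul], by rw [Matrix.mul_assoc, h1, Matrix.mul_one],
    by rw [h1, Matrix.transpose_one], ?_⟩
  rw [Matrix.transpose_mul, Matrix.transpose_mul, Matrix.transpose_transpose,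
    transpose_inv_eq_of_transpose_eq (by rw [Matrix.transpose_mul, Matrix.transpose_transpose]),
    Matrix.mul_assoc]

/-- Full row rank turns `M X M = M` into `M X = 1`, and symmetry of `X M` puts the columns of `X` in
the range of `Mᵀ`. Uniqueness is needed since `pinv` is defined by choice. -/
lemma IsMoorePenrose.eq_of_fullRowRank (h : IsUnit (M * Mᵀ)) {X : Matrix (Fin s) (Fin r) ℝ}
    (hX : IsMoorePenrose M X) : X = Mᵀ * (M * Mᵀ)⁻¹ := by
  obtain ⟨h1, h2, -, h4⟩ := hX
  have hMX : M * X = 1 := by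
    calc M * X = M * X * (M * Mᵀ * (M * Mᵀ)⁻¹) := by
          rw [mul_inv_of_isUnit h, Matrix.mul_one]
      _ = M * X * M * (Mᵀ * (M * Mᵀ)⁻¹) := by rw [Matrix.mul_assoc M Mᵀ, Matrix.mul_assoc (M * X)]
      _ = 1 := by rw [h1, ← Matrix.mul_assoc, mul_inv_of_isUnit h]
  have hX' : X = Mᵀ * (Xᵀ * X) := by
    rw [Matrix.transpose_mul] at h4
    rw [← Matrix.mul_assoc, h4, h2]
  have hG : (M * Mᵀ) * (Xᵀ * X) = 1 := by
    rw [Matrix.mul_assoc, ← hX', hMX]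
  rw [Matrix.inv_eq_right_inv hG, ← hX']

lemma pinv_eq_of_fullRowRank (h : IsUnit (M * Mᵀ)) : pinv M = Mᵀ * (M * Mᵀ)⁻¹ := by
  have hex : ∃ X, IsMoorePenrose M X := ⟨_, isMoorePenrose_of_fullRowRank h⟩
  rw [pinv, dif_pos hex]
  exact hex.choose_spec.eq_of_fullRowRank h

end Pinv

section Covariance
variable {nx n : ℕ} {W : Matrix (Fin (n - nx)) (Fin (n - nx)) ℝ} {g : Fin n → ℝ}

lemma transpose_gram {m l : ℕ} (H : Matrix (Fin l) (Fin m) ℝ) {W : Matrix (Fin m) (Fin m) ℝ}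
    (hW : Wᵀ = W) : (H * W * Hᵀ)ᵀ = H * W * Hᵀ := by
  rw [Matrix.transpose_mul, Matrix.transpose_mul, Matrix.transpose_transpose, hW,
    Matrix.mul_assoc]

/-- The linear map taking the residual to the error of the weighted least-squares estimate. -/
noncomputable def regressionGain {m l : ℕ} (H : Matrix (Fin l) (Fin m) ℝ)
    (W : Matrix (Fin m) (Fin m) ℝ) : Matrix (Fin l) (Fin m) ℝ := (H * W * Hᵀ)⁻¹ * H * W

lemma covLS_eq (h : IsUnit (hankelTop nx g * (hankelTop nx g)ᵀ)) :
    covLS nx W g =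
      regressionGain (hankelTop nx g) 1 * W⁻¹ * (regressionGain (hankelTop nx g) 1)ᵀ := by
  have ht : (hankelTop nx g * (hankelTop nx g)ᵀ)ᵀ = hankelTop nx g * (hankelTop nx g)ᵀ := by
    rw [Matrix.transpose_mul, Matrix.transpose_transpose]
  rw [covLS, pinv_eq_of_fullRowRank h, regressionGain, Matrix.mul_one, Matrix.mul_one,
    Matrix.transpose_mul, Matrix.transpose_mul, Matrix.transpose_transpose,
    transpose_inv_eq_of_transpose_eq ht]

/-- When the weight is the inverse noise covariance, the sandwich formula collapses. -/
lemma inv_gram_eq_regressionGain {m l : ℕ} {H : Matrix (Fin l) (Fin m) ℝ}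
    {W : Matrix (Fin m) (Fin m) ℝ} (hWu : IsUnit W) (hWt : Wᵀ = W) (h : IsUnit (H * W * Hᵀ)) :
    (H * W * Hᵀ)⁻¹ = regressionGain H W * W⁻¹ * (regressionGain H W)ᵀ := by
  rw [regressionGain]
  rw [Matrix.transpose_mul, Matrix.transpose_mul, hWt,
    transpose_inv_eq_of_transpose_eq (transpose_gram H hWt)]
  set G := H * W * Hᵀ with hG
  calc G⁻¹ = G⁻¹ * (G * G⁻¹) := by rw [mul_inv_of_isUnit h, Matrix.mul_one]
    _ = G⁻¹ * H * (W * (Hᵀ * G⁻¹)) := by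
        conv_lhs => enter [2, 1]; rw [hG]
        simp only [Matrix.mul_assoc]
    _ = _ := by rw [Matrix.mul_assoc (G⁻¹ * H) W, mul_inv_of_isUnit hWu, Matrix.mul_one]

lemma covWLS_eq (hWu : IsUnit W) (hWt : Wᵀ = W)
    (h : IsUnit (hankelTop nx g * W * (hankelTop nx g)ᵀ)) :
    covWLS nx W g =
      regressionGain (hankelTop nx g) W * W⁻¹ * (regressionGain (hankelTop nx g) W)ᵀ :=
  inv_gram_eq_regressionGain hWu hWt h

/-- The Gauss–Markov inequality. -/
lemma posSemidef_covLS_sub_covWLS (hW : W.PosDef)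
    (h1 : IsUnit (hankelTop nx g * (hankelTop nx g)ᵀ))
    (h2 : IsUnit (hankelTop nx g * W * (hankelTop nx g)ᵀ)) :
    (covLS nx W g - covWLS nx W g).PosSemidef := by
  have hWt : Wᵀ = W := by
    have := hW.isHermitian.eq
    rwa [Matrix.conjTranspose_eq_transpose_of_trivial] at this
  have hWu : IsUnit W := hW.isUnit
  have key : covLS nx W g - covWLS nx W g =
      (regressionGain (hankelTop nx g) 1 - regressionGain (hankelTop nx g) W) * W⁻¹ *
        (regressionGain (hankelTop nx g) 1 - regressionGain (hankelTop nx g) W)ᵀ := by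
    have hc2 := covWLS_eq hWu hWt h2
    -- The covariance of any unbiased gain `M` with the optimal one equals the optimal covariance,
    -- so the cross terms cancel in the square.
    have hcross : ∀ M : Matrix (Fin nx) (Fin (n - nx)) ℝ, M * (hankelTop nx g)ᵀ = 1 →
        M * W⁻¹ * (regressionGain (hankelTop nx g) W)ᵀ = covWLS nx W g := by
      intro M hM
      rw [covWLS, regressionGain]
      set H := hankelTop nx g
      rw [Matrix.transpose_mul, Matrix.transpose_mul, hWt,
        transpose_inv_eq_of_transpose_eq (transpose_gram H hWt), Matrix.mul_assoc M,
        ← Matrix.mul_assoc W⁻¹, inv_mul_of_isUnit hWu, Matrix.one_mul, ← Matrix.mul_assoc, hM,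
        Matrix.one_mul]
    have hg1 : regressionGain (hankelTop nx g) 1 * (hankelTop nx g)ᵀ = 1 := by
      rw [regressionGain, Matrix.mul_one, Matrix.mul_one, Matrix.mul_assoc,
        inv_mul_of_isUnit h1]
    have hWit : (W⁻¹)ᵀ = W⁻¹ := transpose_inv_eq_of_transpose_eq hWt
    have hx := hcross _ hg1
    have hx' := congrArg Matrix.transpose hx
    have hct : (covWLS nx W g)ᵀ = covWLS nx W g := by
      rw [covWLS]
      exact transpose_inv_eq_of_transpose_eq (transpose_gram _ hWt)
    rw [Matrix.transpose_mul, Matrix.transpose_mul, Matrix.transpose_transpose, hWit, hct,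
      ← Matrix.mul_assoc] at hx'
    rw [Matrix.transpose_sub, Matrix.sub_mul, Matrix.sub_mul, Matrix.mul_sub, Matrix.mul_sub,
      hx, hx', ← covLS_eq h1, ← hc2]
    abel
  rw [key]
  have := hW.inv.posSemidef.mul_mul_conjTranspose_same
    (regressionGain (hankelTop nx g) 1 - regressionGain (hankelTop nx g) W)
  rwa [Matrix.conjTranspose_eq_transpose_of_trivial] at this

end Covariance

lemma dotProduct_gram_mulVec {m l : ℕ} (H : Matrix (Fin l) (Fin m) ℝ)
    (W : Matrix (Fin m) (Fin m) ℝ) (v : Fin l → ℝ) :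
    v ⬝ᵥ ((H * W * Hᵀ) *ᵥ v) = (Hᵀ *ᵥ v) ⬝ᵥ (W *ᵥ (Hᵀ *ᵥ v)) := by
  rw [← dotProduct_transpose_mulVec, Matrix.transpose_transpose, Matrix.mulVec_mulVec,
    Matrix.mulVec_mulVec, Matrix.mul_assoc]

/-! ### Linearization of the estimates -/

section Linearization
open scoped Matrix.Norms.L2Operator

variable {nx : ℕ} {A : Matrix (Fin nx) (Fin nx) ℝ}

lemma exists_opNorm_toeplitz_le (hA : IsSchurStable A) :
    ∃ R : ℝ, 0 ≤ R ∧ ∀ n, ‖toeplitz (charCoeffs A) n‖ ≤ R := by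
  obtain ⟨c, K, -, hK, h⟩ := exists_bounds_toeplitz A hA
  refine ⟨√K, Real.sqrt_nonneg _, fun n => ?_⟩
  refine l2_opNorm_le_of_eucNorm_le (Real.sqrt_nonneg _) fun v => ?_
  refine le_of_sq_le_sq ?_ (by positivity)
  rw [mul_pow, Real.sq_sqrt hK, eucNorm_sq, eucNorm_sq]
  exact (h n v).2

/-- Asymptotic normality asks for Frobenius bounds; passing from the operator norm costs only the
fixed number of rows. -/
lemma sum_sq_le_mul_opNorm_sq {m l : ℕ} (L : Matrix (Fin l) (Fin m) ℝ) :
    ∑ i, ∑ j, L i j ^ 2 ≤ l * ‖L‖ ^ 2 := by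
  calc ∑ i, ∑ j, L i j ^ 2 ≤ ∑ i : Fin l, ‖L‖ ^ 2 := by
        refine Finset.sum_le_sum fun i _ => ?_
        have h := eucNorm_mulVec_le Lᵀ (Pi.single i 1)
        have h1 : eucNorm (Pi.single i (1 : ℝ)) = 1 := by
          rw [eucNorm_eq_sqrt]; simp
        rw [l2_opNorm_transpose, h1, mul_one] at h
        have h2 := pow_le_pow_left₀ (norm_nonneg _) h 2
        rw [eucNorm_sq] at h2
        refine le_trans (le_of_eq ?_) h2
        simp [dotProduct, sq]
    _ = l * ‖L‖ ^ 2 := by simp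

lemma residual_markovVec_add (A : Matrix (Fin nx) (Fin nx) ℝ) (B C : Fin nx → ℝ) {n : ℕ}
    (x : Fin n → ℝ) :
    -hankelBot nx (markovVec A B C n + x) -
      (hankelTop nx (markovVec A B C n + x))ᵀ *ᵥ charCoeffs A =
    -((toeplitz (charCoeffs A) n)ᵀ *ᵥ x) := by
  rw [hankel_residual_eq, Matrix.mulVec_add, toeplitz_transpose_mulVec_markovVec, zero_add]

/-- Both weighted and total least-squares estimates are, up to a quadratic remainder, linear in
the error of the Markov parameters, uniformly in the number of Markov parameters. -/
lemma exists_linearization (hA : IsSchurStable A) {B C : Fin nx → ℝ} (hctrl : IsControllable A B)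
    (hobs : IsObservable A C) {c₀ R₀ : ℝ} (hc₀ : 0 < c₀) :
    ∃ κ K δ₀ R : ℝ, 0 < κ ∧ 0 ≤ K ∧ 0 < δ₀ ∧ ∀ n, 2 * nx ≤ n →
      ∀ W : Matrix (Fin (n - nx)) (Fin (n - nx)) ℝ, Wᵀ = W → ‖W‖ ≤ R₀ →
      (∀ v, c₀ * (v ⬝ᵥ v) ≤ v ⬝ᵥ (W *ᵥ v)) →
      (∀ v, κ * (v ⬝ᵥ v) ≤ v ⬝ᵥ ((hankelTop nx (markovVec A B C n) * W *
        (hankelTop nx (markovVec A B C n))ᵀ) *ᵥ v)) ∧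
      (∀ v, v ⬝ᵥ ((hankelTop nx (markovVec A B C n) * W *
        (hankelTop nx (markovVec A B C n))ᵀ) *ᵥ v) ≤ R * (v ⬝ᵥ v)) ∧
      ∑ i, ∑ j, (-(regressionGain (hankelTop nx (markovVec A B C n)) W *
        (toeplitz (charCoeffs A) n)ᵀ)) i j ^ 2 ≤ R ∧
      (∀ x, eucNorm x ≤ δ₀ → eucNorm (aWLS nx W (markovVec A B C n + x) - charCoeffs A -
        (-(regressionGain (hankelTop nx (markovVec A B C n)) W *
          (toeplitz (charCoeffs A) n)ᵀ)) *ᵥ x) ≤ K * eucNorm x ^ 2) ∧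
      (W = 1 → ∀ x, eucNorm x ≤ δ₀ → eucNorm (aTLS nx (markovVec A B C n + x) - charCoeffs A -
        (-(regressionGain (hankelTop nx (markovVec A B C n)) W *
          (toeplitz (charCoeffs A) n)ᵀ)) *ᵥ x) ≤ K * eucNorm x ^ 2) := by
  obtain ⟨κH, hκH, hH⟩ := exists_hankelTop_coercive hctrl hobs
  obtain ⟨S, hS0, hS⟩ := exists_eucNorm_markovVec_le hA B C
  obtain ⟨RT, hRT0, hRT⟩ := exists_opNorm_toeplitz_le hA
  set R := √nx * S + √nx + RT + |R₀| + eucNorm (charCoeffs A) with hR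
  have hsn := Real.sqrt_nonneg (nx : ℝ)
  have hsnS : 0 ≤ √nx * S := by positivity
  have ha0 := norm_nonneg (WithLp.toLp 2 (charCoeffs A))
  have habs := abs_nonneg R₀
  have hR0 : 0 ≤ R := by positivity
  have hκ : 0 < c₀ * κH := by positivity
  obtain ⟨K, δ₀, hK, hδ₀, hδR, hmain⟩ := exists_linearization_constants R (c₀ * κH) hR0 hκ
  refine ⟨c₀ * κH, K, δ₀, max (R * R * R) (nx * ((c₀ * κH)⁻¹ * R * R * R) ^ 2), hκ, hK, hδ₀,
    fun n hn W hWt hWR hWc => ?_⟩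
  set g := markovVec A B C n
  set H := hankelTop nx g
  have hHR : ‖H‖ ≤ R := by
    have := (opNorm_hankelTop_le nx g).trans (mul_le_mul_of_nonneg_left (hS n) hsn)
    linarith
  have hWR' : ‖W‖ ≤ R := by
    have := le_abs_self R₀
    linarith
  have hTR : ‖(toeplitz (charCoeffs A) n)ᵀ‖ ≤ R := by
    rw [l2_opNorm_transpose]
    linarith [hRT n]
  have hGc : ∀ v, c₀ * κH * (v ⬝ᵥ v) ≤ v ⬝ᵥ ((H * W * Hᵀ) *ᵥ v) := by
    intro v
    rw [dotProduct_gram_mulVec, mul_assoc]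
    exact (mul_le_mul_of_nonneg_left (hH n hn v) hc₀.le).trans (hWc _)
  have hHWT : ‖H * W * Hᵀ‖ ≤ R * R * R := by
    refine (Matrix.l2_opNorm_mul _ _).trans ?_
    rw [l2_opNorm_transpose]
    gcongr
    exact (Matrix.l2_opNorm_mul _ _).trans (by gcongr)
  set T := (toeplitz (charCoeffs A) n)ᵀ
  have hunit := isUnit_of_coercive hκ hGc
  -- The candidate linear term solves the unperturbed normal equations exactly.
  have hD₀ : ∀ x, (H * W * Hᵀ) *ᵥ ((-(regressionGain H W * T)) *ᵥ x) = H *ᵥ (W *ᵥ (-(T *ᵥ x))) := by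
    intro x
    rw [regressionGain, Matrix.mul_assoc _ H W, Matrix.mul_assoc _ (H * W), Matrix.mulVec_mulVec,
      Matrix.mul_neg, ← Matrix.mul_assoc (H * W * Hᵀ), mul_inv_of_isUnit hunit, Matrix.one_mul]
    simp only [Matrix.mulVec_neg, Matrix.neg_mulVec, Matrix.mulVec_mulVec, Matrix.mul_assoc]
  have hpert : ∀ x, ‖H - hankelTop nx (g + x)‖ ≤ R * eucNorm x := by
    intro x
    rw [hankelTop_add, sub_add_cancel_left, norm_neg]
    refine (opNorm_hankelTop_le nx x).trans ?_
    gcongr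
    linarith
  have he : ∀ x, eucNorm (-(T *ᵥ x)) ≤ R * eucNorm x := by
    intro x
    rw [eucNorm_neg]
    exact (eucNorm_mulVec_le _ _).trans (by gcongr)
  have haR : eucNorm (charCoeffs A) ≤ R := by linarith
  refine ⟨hGc, fun v => ?_, ?_, ?_, ?_⟩
  · exact ((le_abs_self _).trans (dotProduct_mulVec_le_opNorm _ _)).trans
      (mul_le_mul_of_nonneg_right (hHWT.trans (le_max_left _ _)) (dotProduct_self_nonneg' v))
  · refine (sum_sq_le_mul_opNorm_sq _).trans (le_trans ?_ (le_max_right _ _))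
    gcongr
    rw [norm_neg, regressionGain]
    refine (Matrix.l2_opNorm_mul _ _).trans ?_
    gcongr
    refine (Matrix.l2_opNorm_mul _ _).trans ?_
    gcongr
    refine (Matrix.l2_opNorm_mul _ _).trans ?_
    gcongr
    exact l2_opNorm_inv_le_of_coercive hκ hGc
  · intro x hx
    obtain ⟨hco, hlin⟩ := hmain H (hankelTop nx (g + x)) W (eucNorm x) hHR hWR' hGc
      (norm_nonneg _) hx (hpert x)
    refine hlin (charCoeffs A) _ _ (-(T *ᵥ x)) 0 haR (he x) (by rw [abs_zero]; positivity) ?_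
      (hD₀ x)
    have hne := mulVec_uniqueSol_isWLS (Φ := (hankelTop nx (g + x))ᵀ) hWt (-hankelBot nx (g + x))
      (κ := c₀ * κH / 2) (by positivity) (by rwa [Matrix.transpose_transpose])
    rw [Matrix.transpose_transpose] at hne
    rw [zero_smul, zero_smul, sub_zero, add_zero, ← residual_markovVec_add A B C x,
      Matrix.mulVec_sub, aWLS, hne]
    simp only [Matrix.mulVec_sub, Matrix.mulVec_mulVec, Matrix.mul_assoc, g]
  · rintro rfl x hx
    obtain ⟨hco, hlin⟩ := hmain H (hankelTop nx (g + x)) 1 (eucNorm x) hHR hWR' hGc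
      (norm_nonneg _) hx (hpert x)
    have hr2 : (-(T *ᵥ x)) ⬝ᵥ (-(T *ᵥ x)) ≤ R ^ 2 * eucNorm x ^ 2 := by
      rw [← eucNorm_sq, ← mul_pow]
      exact pow_le_pow_left₀ (norm_nonneg _) (he x) 2
    -- `κ / 16` is one eighth of the halved coercivity constant of the perturbed Gram matrix, the
    -- threshold for existence of the total least-squares solution.
    have hr3 : R ^ 2 * eucNorm x ^ 2 ≤ c₀ * κH / 16 := le_trans (by gcongr) hδR
    obtain ⟨c, hc0, hc1, hne⟩ := mulVec_uniqueSol_isTLS (Φ := (hankelTop nx (g + x))ᵀ)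
      (z := -hankelBot nx (g + x)) (κ := c₀ * κH / 2) (by positivity) (fun v => by
        have := hco v
        rwa [dotProduct_gram_mulVec, Matrix.one_mulVec] at this) (charCoeffs A) (by
        rw [residual_markovVec_add]
        linarith)
    rw [residual_markovVec_add] at hc1
    refine hlin (charCoeffs A) _ _ (-(T *ᵥ x)) c haR (he x)
      (by rw [abs_of_nonneg hc0]; linarith) ?_ (hD₀ x)
    rw [Matrix.transpose_transpose] at hne
    rw [Matrix.mul_one, Matrix.one_mulVec, ← residual_markovVec_add A B C x, Matrix.mulVec_sub,
      Matrix.mulVec_sub, ← hne, aTLS, smul_sub, Matrix.mulVec_mulVec]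
    abel

end Linearization

/-! ### Positive definite weights and bounds on the covariances -/

section Weight
variable {nx : ℕ}

lemma isHermitian_of_transpose_eq {k : ℕ} {M : Matrix (Fin k) (Fin k) ℝ} (h : Mᵀ = M) :
    M.IsHermitian := by
  rw [Matrix.IsHermitian, Matrix.conjTranspose_eq_transpose_of_trivial, h]

lemma transpose_eq_of_isHermitian {k : ℕ} {M : Matrix (Fin k) (Fin k) ℝ} (h : M.IsHermitian) :
    Mᵀ = M := by
  rw [← Matrix.conjTranspose_eq_transpose_of_trivial]; exact h

lemma mul_toeplitz_transpose_covariance {k l m : ℕ} (L : Matrix (Fin k) (Fin l) ℝ)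
    (T : Matrix (Fin m) (Fin l) ℝ) (P : Matrix (Fin m) (Fin m) ℝ) :
    (-(L * Tᵀ)) * P * (-(L * Tᵀ))ᵀ = L * (Tᵀ * P * T) * Lᵀ := by
  rw [Matrix.transpose_neg, Matrix.transpose_mul, Matrix.transpose_transpose, Matrix.neg_mul,
    Matrix.neg_mul, Matrix.mul_neg, neg_neg]
  simp only [Matrix.mul_assoc]

lemma posDef_weight {A : Matrix (Fin nx) (Fin nx) ℝ} (hA : IsSchurStable A) {n : ℕ}
    {P : Matrix (Fin n) (Fin n) ℝ} (hP : P.PosDef) : (weight (charCoeffs A) P).PosDef := by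
  obtain ⟨c, K, hc, -, h⟩ := exists_bounds_toeplitz A hA
  have hinj : Function.Injective (toeplitz (charCoeffs A) n).mulVec := by
    intro x y hxy
    have h0 : toeplitz (charCoeffs A) n *ᵥ (x - y) = 0 := by
      rw [Matrix.mulVec_sub]; exact sub_eq_zero.2 hxy
    have h1 := (h n (x - y)).1
    rw [h0, dotProduct_zero] at h1
    exact sub_eq_zero.1 (eq_zero_of_dotProduct_self_le_zero (by nlinarith))
  have := hP.conjTranspose_mul_mul_same hinj
  rw [Matrix.conjTranspose_eq_transpose_of_trivial] at this
  exact this.inv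

/-- Uniform bounds for the covariance of a weighted least-squares estimate with the weight
matched to the noise. -/
lemma posSemidef_bounds_inv_gram {m l : ℕ} {H : Matrix (Fin l) (Fin m) ℝ}
    {W : Matrix (Fin m) (Fin m) ℝ} (hW : Wᵀ = W) {κ R : ℝ} (hκ : 0 < κ)
    (hlow : ∀ v, κ * (v ⬝ᵥ v) ≤ v ⬝ᵥ ((H * W * Hᵀ) *ᵥ v))
    (hup : ∀ v, v ⬝ᵥ ((H * W * Hᵀ) *ᵥ v) ≤ R * (v ⬝ᵥ v)) :
    ((H * W * Hᵀ)⁻¹ - (max R 1)⁻¹ • 1).PosSemidef ∧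
      (κ⁻¹ • 1 - (H * W * Hᵀ)⁻¹).PosSemidef := by
  have ht := transpose_gram H hW
  have hherm := isHermitian_of_transpose_eq (transpose_inv_eq_of_transpose_eq ht)
  exact ⟨posSemidef_sub_smul_one hherm (le_dotProduct_inv_mulVec ht hκ (by positivity) hlow
      fun v => (hup v).trans
        (mul_le_mul_of_nonneg_right (le_max_left _ _) (dotProduct_self_nonneg' v))),
    posSemidef_smul_one_sub hherm (dotProduct_inv_mulVec_le hκ hlow)⟩

/-- Uniform bounds for the covariance of the ordinary least-squares estimate. -/
lemma posSemidef_bounds_regressionGain {m l : ℕ} {H : Matrix (Fin l) (Fin m) ℝ}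
    {V : Matrix (Fin m) (Fin m) ℝ} (hV : Vᵀ = V) {κ R c K : ℝ} (hκ : 0 < κ) (hc : 0 < c)
    (hK : 0 < K)
    (hlow : ∀ v, κ * (v ⬝ᵥ v) ≤ v ⬝ᵥ ((H * (1 : Matrix (Fin m) (Fin m) ℝ) * Hᵀ) *ᵥ v))
    (hup : ∀ v, v ⬝ᵥ ((H * (1 : Matrix (Fin m) (Fin m) ℝ) * Hᵀ) *ᵥ v) ≤ R * (v ⬝ᵥ v))
    (hVlow : ∀ v, c * (v ⬝ᵥ v) ≤ v ⬝ᵥ (V *ᵥ v)) (hVup : ∀ v, v ⬝ᵥ (V *ᵥ v) ≤ K * (v ⬝ᵥ v)) :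
    (regressionGain H 1 * V * (regressionGain H 1)ᵀ - (c * (max R 1)⁻¹) • 1).PosSemidef ∧
      ((K * κ⁻¹) • 1 - regressionGain H 1 * V * (regressionGain H 1)ᵀ).PosSemidef := by
  obtain ⟨h1, h2⟩ := posSemidef_bounds_inv_gram Matrix.transpose_one hκ hlow hup
  -- For the unit weight `L Lᵀ = (H Hᵀ)⁻¹`, so bounds on `L V Lᵀ` are products of bounds on `V` and
  -- on the inverse Gram matrix.
  have hLL := inv_gram_eq_regressionGain isUnit_one Matrix.transpose_one
    (isUnit_of_coercive hκ hlow)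
  rw [inv_one, Matrix.mul_one (regressionGain H 1)] at hLL
  rw [hLL] at h1 h2
  generalize regressionGain H 1 = L at h1 h2
  have hLq : ∀ v, (Lᵀ *ᵥ v) ⬝ᵥ (Lᵀ *ᵥ v) = v ⬝ᵥ ((L * Lᵀ) *ᵥ v) := fun v => by
    rw [← dotProduct_transpose_mulVec, Matrix.transpose_transpose, Matrix.mulVec_mulVec]
  have hherm : (L * V * Lᵀ).IsHermitian := isHermitian_of_transpose_eq (transpose_gram L hV)
  refine ⟨posSemidef_sub_smul_one hherm fun v => ?_, posSemidef_smul_one_sub hherm fun v => ?_⟩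
  · rw [dotProduct_gram_mulVec, mul_assoc]
    refine le_trans ?_ (hVlow _)
    rw [hLq]
    exact mul_le_mul_of_nonneg_left (le_dotProduct_mulVec_of_posSemidef h1 v) hc.le
  · rw [dotProduct_gram_mulVec, mul_assoc]
    refine (hVup _).trans ?_
    rw [hLq]
    exact mul_le_mul_of_nonneg_left (dotProduct_mulVec_le_of_posSemidef h2 v) hK.le

end Weight

/-! ### Proof of the theorem -/

theorem theorem3 {Ω : Type*} [MeasurableSpace Ω] (μ : Measure Ω) [IsProbabilityMeasure μ]
    -- the system: stable and minimal
    (nx : ℕ) (A : Matrix (Fin nx) (Fin nx) ℝ) (B C : Fin nx → ℝ)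
    (hstable : IsSchurStable A) (hctrl : IsControllable A B) (hobs : IsObservable A C)
    -- the number of Markov parameters as a function of the sample size
    (n : ℕ → ℕ)
    (hn_top : Tendsto n atTop atTop)
    (hn_rate : ∃ δ : ℝ, 0 < δ ∧
      Tendsto (fun N : ℕ => (n N : ℝ) ^ (4 + δ) / (N : ℝ)) atTop (𝓝 0))
    (hn_tail : Tendsto (fun N : ℕ => √(N : ℝ) * ∑' k : ℕ, |markov A B C (n N + k)|) atTop (𝓝 0))
    -- the estimates of the Markov parameters: consistent and asymptotically normal
    (ghat : (N : ℕ) → Ω → Fin (n N) → ℝ)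
    (hmeas : ∀ N, AEMeasurable (ghat N) μ)
    (hcons : ∀ᵐ ω ∂μ, Tendsto
      (fun N => ‖WithLp.toLp 2 (ghat N ω - markovVec A B C (n N))‖) atTop (𝓝 0))
    (P : (N : ℕ) → Matrix (Fin (n N)) (Fin (n N)) ℝ)
    (hP : ∀ N, (P N).PosDef)
    (hnormal : AsymptoticallyNormal μ n
      (fun N ω => √(N : ℝ) • (ghat N ω - markovVec A B C (n N))) P) :
    AsymptoticallyNormal μ (fun _ => nx)
      (fun N ω => √(N : ℝ) • (aOLS nx (ghat N ω) - charCoeffs A))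
      (fun N => covLS nx (weight (charCoeffs A) (P N)) (markovVec A B C (n N))) ∧
    AsymptoticallyNormal μ (fun _ => nx)
      (fun N ω => √(N : ℝ) • (aTLS nx (ghat N ω) - charCoeffs A))
      (fun N => covLS nx (weight (charCoeffs A) (P N)) (markovVec A B C (n N))) ∧
    AsymptoticallyNormal μ (fun _ => nx)
      (fun N ω => √(N : ℝ) •
        (aWLS nx (weight (charCoeffs A) (P N)) (ghat N ω) - charCoeffs A))
      (fun N => covWLS nx (weight (charCoeffs A) (P N)) (markovVec A B C (n N))) ∧
    ∀ N, 2 * nx + 1 ≤ n N →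
      (covLS nx (weight (charCoeffs A) (P N)) (markovVec A B C (n N)) -
        covWLS nx (weight (charCoeffs A) (P N)) (markovVec A B C (n N))).PosSemidef := by
  obtain ⟨δ, hδ, hrate⟩ := hn_rate
  have hrate' := tendsto_div_sqrt_of_rate hδ hrate
  obtain ⟨cT, KT, hcT, hKT, hT⟩ := exists_bounds_toeplitz A hstable
  obtain ⟨⟨cP, KP, hcP, hPbd⟩, -⟩ := id hnormal
  set a := charCoeffs A
  set V : (N : ℕ) → Matrix (Fin (n N - nx)) (Fin (n N - nx)) ℝ := fun N =>
    (toeplitz a (n N))ᵀ * P N * toeplitz a (n N) with hVdef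
  have hW : ∀ N, weight a (P N) = (V N)⁻¹ := fun N => rfl
  have hVt : ∀ N, (V N)ᵀ = V N := fun N => by
    simp only [hVdef, Matrix.transpose_mul, Matrix.transpose_transpose,
      transpose_eq_of_isHermitian (hP N).isHermitian, Matrix.mul_assoc]
  set cV := cP * cT
  have hcV : 0 < cV := mul_pos hcP hcT
  -- The absolute value and the summand 1 secure a positive bound, as the sign of `KP` is not given.
  set KV := |KP| * KT + 1
  have hKV : 0 < KV := by positivity
  have hVquad : ∀ N v, v ⬝ᵥ (V N *ᵥ v) =
      (toeplitz a (n N) *ᵥ v) ⬝ᵥ (P N *ᵥ (toeplitz a (n N) *ᵥ v)) := fun N v => by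
    rw [← dotProduct_transpose_mulVec, Matrix.mulVec_mulVec, Matrix.mulVec_mulVec]
  have hVlow : ∀ᶠ N in atTop, ∀ v, cV * (v ⬝ᵥ v) ≤ v ⬝ᵥ (V N *ᵥ v) := by
    filter_upwards [hPbd] with N hN v
    rw [hVquad, mul_assoc]
    exact (mul_le_mul_of_nonneg_left (hT _ v).1 hcP.le).trans
      (le_dotProduct_mulVec_of_posSemidef hN.1 _)
  have hVup : ∀ᶠ N in atTop, ∀ v, v ⬝ᵥ (V N *ᵥ v) ≤ KV * (v ⬝ᵥ v) := by
    filter_upwards [hPbd] with N hN v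
    have h1 := dotProduct_mulVec_le_of_posSemidef hN.2 (toeplitz a (n N) *ᵥ v)
    have h2 := dotProduct_self_nonneg' (toeplitz a (n N) *ᵥ v)
    have h3 := mul_le_mul_of_nonneg_right (le_abs_self KP) h2
    have h4 := mul_le_mul_of_nonneg_left (hT _ v).2 (abs_nonneg KP)
    have h5 := dotProduct_self_nonneg' v
    rw [hVquad]
    simp only [KV]
    linarith
  have hn_ev : ∀ᶠ N in atTop, 2 * nx ≤ n N := hn_top.eventually_ge_atTop _
  -- Two linearizations: unit weight, for ordinary and total least squares together, and the weight
  -- `V⁻¹`, whose uniform bounds come from those of `V`.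
  obtain ⟨κ₁, C₁, δ₁, R₁, hκ₁, hC₁, hδ₁, hlin₁⟩ :=
    exists_linearization hstable hctrl hobs (c₀ := 1) (R₀ := 1) one_pos
  obtain ⟨κ₂, C₂, δ₂, R₂, hκ₂, hC₂, hδ₂, hlin₂⟩ :=
    exists_linearization hstable hctrl hobs (c₀ := KV⁻¹) (R₀ := cV⁻¹) (inv_pos.2 hKV)
  have hl₁ := fun N (hN : 2 * nx ≤ n N) => hlin₁ (n N) hN 1 Matrix.transpose_one
    (l2_opNorm_le_of_eucNorm_le zero_le_one fun v => by rw [Matrix.one_mulVec, one_mul])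
    fun v => by rw [Matrix.one_mulVec, one_mul]
  have hl₂ := fun N (hN : 2 * nx ≤ n N) (h1 : ∀ v, cV * (v ⬝ᵥ v) ≤ v ⬝ᵥ (V N *ᵥ v))
      (h2 : ∀ v, v ⬝ᵥ (V N *ᵥ v) ≤ KV * (v ⬝ᵥ v)) =>
    hlin₂ (n N) hN (V N)⁻¹ (transpose_inv_eq_of_transpose_eq (hVt N))
      (l2_opNorm_inv_le_of_coercive hcV h1)
      (le_dotProduct_inv_mulVec (hVt N) hcV hKV h1 h2)
  have hinvinv : ∀ᶠ N in atTop, (V N)⁻¹⁻¹ = V N := by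
    filter_upwards [hVlow] with N h1
    exact Matrix.nonsing_inv_nonsing_inv _
      ((Matrix.isUnit_iff_isUnit_det _).1 (isUnit_of_coercive hcV h1))
  have hLSeq : ∀ᶠ N in atTop, covLS nx (weight a (P N)) (markovVec A B C (n N)) =
      regressionGain (hankelTop nx (markovVec A B C (n N))) 1 * V N *
        (regressionGain (hankelTop nx (markovVec A B C (n N))) 1)ᵀ := by
    filter_upwards [hn_ev, hinvinv] with N hN hi
    have hu := isUnit_of_coercive hκ₁ (hl₁ N hN).1
    rw [Matrix.mul_one] at hu
    rw [covLS_eq hu, hW, hi]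
  have hLSV : ∀ᶠ N in atTop, covLS nx (weight a (P N)) (markovVec A B C (n N)) =
      (-(regressionGain (hankelTop nx (markovVec A B C (n N))) 1 * (toeplitz a (n N))ᵀ)) * P N *
        (-(regressionGain (hankelTop nx (markovVec A B C (n N))) 1 * (toeplitz a (n N))ᵀ))ᵀ := by
    filter_upwards [hLSeq] with N h
    rw [h, mul_toeplitz_transpose_covariance]
  have hLSbd : ∃ c K : ℝ, 0 < c ∧ ∀ᶠ N in atTop,
      (covLS nx (weight a (P N)) (markovVec A B C (n N)) - c • 1).PosSemidef ∧
        (K • 1 - covLS nx (weight a (P N)) (markovVec A B C (n N))).PosSemidef := by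
    refine ⟨cV * (max R₁ 1)⁻¹, KV * κ₁⁻¹, by positivity, ?_⟩
    filter_upwards [hn_ev, hLSeq, hVlow, hVup] with N hN heq hlo hup
    obtain ⟨hG1, hG2, -⟩ := hl₁ N hN
    rw [heq]
    exact posSemidef_bounds_regressionGain (hVt N) hκ₁ hcV hKV hG1 hG2 hlo hup
  refine ⟨?_, ?_, ?_, ?_⟩
  · refine hnormal.of_linearization hn_top hrate' hmeas
      (est := fun N => aOLS nx) (fun N => ?_) (a := a) hC₁ hδ₁ ?_ ?_ hLSV hLSbd (R := R₁)
    · rw [aOLS_eq_aWLS_one]; exact measurable_aWLS nx (n N) 1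
    · filter_upwards [hn_ev] with N hN
      rw [aOLS_eq_aWLS_one]
      exact (hl₁ N hN).2.2.2.1
    · filter_upwards [hn_ev] with N hN using (hl₁ N hN).2.2.1
  · refine hnormal.of_linearization hn_top hrate' hmeas
      (est := fun N => aTLS nx) (fun N => measurable_aTLS nx (n N)) (a := a) hC₁ hδ₁ ?_ ?_
      hLSV hLSbd (R := R₁)
    · filter_upwards [hn_ev] with N hN using (hl₁ N hN).2.2.2.2 rfl
    · filter_upwards [hn_ev] with N hN using (hl₁ N hN).2.2.1
  · refine hnormal.of_linearization hn_top hrate' hmeas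
      (est := fun N => aWLS nx (weight a (P N))) (fun N => measurable_aWLS nx (n N) _) (a := a)
      (L := fun N => -(regressionGain (hankelTop nx (markovVec A B C (n N))) (V N)⁻¹ *
        (toeplitz a (n N))ᵀ)) hC₂ hδ₂ ?_ ?_ ?_ ?_ (R := R₂)
    · filter_upwards [hn_ev, hVlow, hVup] with N hN h1 h2 using (hl₂ N hN h1 h2).2.2.2.1
    · filter_upwards [hn_ev, hVlow, hVup] with N hN h1 h2 using (hl₂ N hN h1 h2).2.2.1
    · filter_upwards [hn_ev, hVlow, hVup, hinvinv] with N hN h1 h2 hi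
      rw [mul_toeplitz_transpose_covariance]
      have hu := isUnit_of_coercive hκ₂ (hl₂ N hN h1 h2).1
      have huV := isUnit_of_coercive hcV h1
      rw [hW, covWLS_eq ((Matrix.isUnit_nonsing_inv_iff).2 huV)
        (transpose_inv_eq_of_transpose_eq (hVt N)) hu, hi]
    · refine ⟨(max R₂ 1)⁻¹, κ₂⁻¹, by positivity, ?_⟩
      filter_upwards [hn_ev, hVlow, hVup] with N hN h1 h2
      obtain ⟨hG1, hG2, -⟩ := hl₂ N hN h1 h2
      exact posSemidef_bounds_inv_gram (transpose_inv_eq_of_transpose_eq (hVt N)) hκ₂ hG1 hG2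
  -- Nothing asymptotic is used here: each `P N` is positive definite, and `H⁺` has full row rank as
  -- soon as `n ≥ 2 nx`.
  · intro N hN
    obtain ⟨κ, hκ, hH⟩ := exists_hankelTop_coercive hctrl hobs
    have hcoer := hH (n N) (by omega)
    have hWpd := posDef_weight hstable (hP N)
    refine posSemidef_covLS_sub_covWLS hWpd ?_ ?_
    · refine isUnit_of_coercive hκ fun v => ?_
      refine (hcoer v).trans (le_of_eq ?_)
      rw [← dotProduct_transpose_mulVec, Matrix.transpose_transpose, Matrix.mulVec_mulVec]
    · have hinj : Function.Injective ((hankelTop nx (markovVec A B C (n N)))ᵀ).mulVec := by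
        intro x y hxy
        have h0 : (hankelTop nx (markovVec A B C (n N)))ᵀ *ᵥ (x - y) = 0 := by
          rw [Matrix.mulVec_sub]; exact sub_eq_zero.2 hxy
        have h1 := hcoer (x - y)
        rw [h0, dotProduct_zero] at h1
        exact sub_eq_zero.1 (eq_zero_of_dotProduct_self_le_zero (by nlinarith))
      have := hWpd.conjTranspose_mul_mul_same hinj
      rw [Matrix.conjTranspose_eq_transpose_of_trivial, Matrix.transpose_transpose] at this
      exact this.isUnit
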